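/- Let $A$ be a nonzero finite-dimensional complex Hilbert space, identified with $\mathbb{C}^n$ ($n\ge 1$) by an orthonormal basis $|i\rangle$; let $L(A)$ be its operators, $B$ a copy of $A$, and $|\Phi\rangle=\sum_i |i\rangle\otimes|i\rangle\in A\otimes B$. A non-commutative graph is a subspace $S\subseteq L(A)$ with $S=S^\dagger$ and $I\in S$. For positive semidefinite $W\in L(A)$ let $$\theta(S,W)=\min\{\lambda\in\mathbb{R} : Y\in S\otimes L(B),\ \mathrm{Tr}_A Y\le\lambda I,\ Y\ge |r_W\rangle\langle r_W|\},\qquad |r_W\rangle=(\sqrt W\otimes I)|\Phi\rangle .$$ Let $S_0\subseteq L(A)$ be a (unital) $C^*$-algebra, let $S_0'\subseteq L(A)$ be its commutant, and let $S^\perp$ be the orthogonal complement of $S$ for the Hilbert–Schmidt inner product $\mathrm{Tr}(X^\dagger Y)$. A non-commutative graph $S$ is an $S_0$-graph if $S_0\subseteq S$ and $S_0SS_0=S$ (products of subspaces being linear spans of products). There is an orthogonal decomposition, with nonzero $A_i$, $Y_i$, $$A=\bigoplus_{i=1}^r A_i\otimes Y_i\quad\text{with}\quad S_0=\bigoplus_{i=1}^r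 L(A_i)\otimes I_{Y_i}.$$ For any such decomposition let $P_i$ be the projector onto $A_i\otimes Y_i$ and $D=\sum_i(\dim A_i)^{-1}(\dim Y_i)P_i$. **Theorem.** Let $S$ be an $S_0$-graph. Then for all positive semidefinite $V,W\in L(A)$, $$\theta(S,V)\,\theta(S^\perp+S_0,W)\ \ge\ \mathrm{Tr}\big(V\sqrt D\,W\sqrt D\big).$$ Moreover, for every positive semidefinite $V\in S_0'$ there is a nonzero positive semidefinite $W\in S_0'$ for which equality holds, and for every positive semidefinite $W\in S_0'$ there is a nonzero positive semidefinite $V\in S_0'$ for which equality holds. -/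

import Mathlib

open scoped Kronecker ComplexOrder MatrixOrder

/-! Operators on the Hilbert space `A = ℂⁿ` (coordinates indexed by a finite type `n`) are matrices
`Matrix n n ℂ`; operators on `A ⊗ B`, with `B` a copy of `A`, are matrices indexed by `n × n`. -/

namespace WeightedTheta

noncomputable section

/-- A non-commutative graph: an operator subspace `S` with `S = S†` and `I ∈ S`. -/
structure IsNCGraph {n : Type*} [Fintype n] [DecidableEq n]
    (S : Submodule ℂ (Matrix n n ℂ)) : Prop where
  conjTranspose_mem : ∀ X ∈ S, X.conjTranspose ∈ S
  one_mem : (1 : Matrix n n ℂ) ∈ S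

/-- The underlying linear subspace of a (finite-dimensional, unital) C*-algebra of matrices. -/
def vertexSpace {n : Type*} [Fintype n] [DecidableEq n]
    (S₀ : StarSubalgebra ℂ (Matrix n n ℂ)) : Submodule ℂ (Matrix n n ℂ) :=
  Subalgebra.toSubmodule S₀.toSubalgebra

/-- `S` is an `S₀`-graph: a non-commutative graph with `S₀ ⊆ S` and `S₀ S S₀ = S`, where products of
subspaces are linear spans of products. -/
structure IsGraphOver {n : Type*} [Fintype n] [DecidableEq n]
    (S₀ : StarSubalgebra ℂ (Matrix n n ℂ)) (S : Submodule ℂ (Matrix n n ℂ)) : Prop where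
  isNCGraph : IsNCGraph S
  vertexSpace_le : vertexSpace S₀ ≤ S
  bimodule : vertexSpace S₀ * S * vertexSpace S₀ = S

/-- The orthogonal complement `S^⊥` for the Hilbert–Schmidt inner product `Tr(Y† X)`. -/
def hsOrthogonal {n : Type*} [Fintype n]
    (S : Submodule ℂ (Matrix n n ℂ)) : Submodule ℂ (Matrix n n ℂ) where
  carrier := {X | ∀ Y ∈ S, (Y.conjTranspose * X).trace = 0}
  add_mem' := fun ha hb Y hY => by
    rw [Matrix.mul_add, Matrix.trace_add, ha Y hY, hb Y hY, add_zero]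
  zero_mem' := fun Y _ => by simp
  smul_mem' := fun c X hX Y hY => by
    rw [Matrix.mul_smul, Matrix.trace_smul, hX Y hY, smul_zero]

/-- The complement `S^⊥ + S₀` of an `S₀`-graph `S`. -/
def graphCompl {n : Type*} [Fintype n] [DecidableEq n]
    (S₀ : StarSubalgebra ℂ (Matrix n n ℂ)) (S : Submodule ℂ (Matrix n n ℂ)) :
    Submodule ℂ (Matrix n n ℂ) :=
  hsOrthogonal S ⊔ vertexSpace S₀

/-- The operator subspace `S ⊗ L(B)` of `L(A ⊗ B)`. -/
def tensorFull {n : Type*} (S : Submodule ℂ (Matrix n n ℂ)) :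
    Submodule ℂ (Matrix (n × n) (n × n) ℂ) :=
  Submodule.span ℂ {M | ∃ X ∈ S, ∃ Z : Matrix n n ℂ, M = X ⊗ₖ Z}

/-- The partial trace `Tr_A : L(A ⊗ B) → L(B)`. -/
def partialTraceA {n : Type*} [Fintype n] (Y : Matrix (n × n) (n × n) ℂ) : Matrix n n ℂ :=
  Matrix.of fun b b' => ∑ a, Y (a, b) (a, b')

/-- The unnormalized maximally entangled vector `|Φ⟩ = ∑ᵢ |i⟩ ⊗ |i⟩` in `A ⊗ B`. -/
def maxEntangled (n : Type*) [DecidableEq n] : n × n → ℂ :=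
  fun p => if p.1 = p.2 then 1 else 0

/-- The vectorization `|M⟩ = (M ⊗ I)|Φ⟩` of an operator `M` on `A`. -/
def vectorize {n : Type*} [Fintype n] [DecidableEq n] (M : Matrix n n ℂ) : n × n → ℂ :=
  (M ⊗ₖ (1 : Matrix n n ℂ)).mulVec (maxEntangled n)

/-- The rank-one operator `|v⟩⟨v|`. -/
def ketBra {m : Type*} (v : m → ℂ) : Matrix m m ℂ :=
  Matrix.vecMulVec v (star v)

/-- The weighted theta function
`θ(S, W) = min {lam : Y ∈ S ⊗ L(B), Tr_A Y ≤ lam I, Y ≥ |√W⟩⟨√W|}`. -/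
def theta {n : Type*} [Fintype n] [DecidableEq n]
    (S : Submodule ℂ (Matrix n n ℂ)) (W : Matrix n n ℂ) : ℝ :=
  sInf {lam : ℝ | ∃ Y ∈ tensorFull S,
    ((lam : ℂ) • (1 : Matrix n n ℂ) - partialTraceA Y).PosSemidef ∧
    (Y - ketBra (vectorize (CFC.sqrt W))).PosSemidef}

/-- A decomposition `A = ⨁ᵢ Aᵢ ⊗ Yᵢ` (orthogonal, realized by the unitary `U`), with
`dim Aᵢ = dimA i` and `dim Yᵢ = dimY i`, for which `S₀ = ⨁ᵢ L(Aᵢ) ⊗ I`. -/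
structure BlockDecomposition {n : Type*} [Fintype n] [DecidableEq n]
    (S₀ : StarSubalgebra ℂ (Matrix n n ℂ)) where
  r : ℕ
  dimA : Fin r → ℕ
  dimY : Fin r → ℕ
  dimA_pos : ∀ i, 0 < dimA i
  dimY_pos : ∀ i, 0 < dimY i
  U : Matrix n (Σ i : Fin r, Fin (dimA i) × Fin (dimY i)) ℂ
  conjTranspose_mul_self : U.conjTranspose * U = 1
  mul_conjTranspose_self : U * U.conjTranspose = 1
  mem_iff : ∀ X : Matrix n n ℂ, X ∈ S₀ ↔
    ∃ M : (i : Fin r) → Matrix (Fin (dimA i)) (Fin (dimA i)) ℂ,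
      X = U * (Matrix.blockDiagonal'
        (fun i => M i ⊗ₖ (1 : Matrix (Fin (dimY i)) (Fin (dimY i)) ℂ)) :
          Matrix (Σ i : Fin r, Fin (dimA i) × Fin (dimY i))
            (Σ i : Fin r, Fin (dimA i) × Fin (dimY i)) ℂ) * U.conjTranspose

/-- The orthogonal projector `Pᵢ` of `A` onto `Aᵢ ⊗ Yᵢ`. -/
def BlockDecomposition.proj {n : Type*} [Fintype n] [DecidableEq n]
    {S₀ : StarSubalgebra ℂ (Matrix n n ℂ)} (d : BlockDecomposition S₀) (i : Fin d.r) :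
    Matrix n n ℂ :=
  d.U * (Matrix.diagonal fun k => if k.1 = i then 1 else 0 :
    Matrix (Σ i : Fin d.r, Fin (d.dimA i) × Fin (d.dimY i))
      (Σ i : Fin d.r, Fin (d.dimA i) × Fin (d.dimY i)) ℂ) * d.U.conjTranspose

/-- The scaling operator `D = ∑ᵢ (dim Aᵢ)⁻¹ (dim Yᵢ) Pᵢ`. -/
def BlockDecomposition.scaling {n : Type*} [Fintype n] [DecidableEq n]
    {S₀ : StarSubalgebra ℂ (Matrix n n ℂ)} (d : BlockDecomposition S₀) : Matrix n n ℂ :=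
  ∑ i, ((d.dimA i : ℂ)⁻¹ * (d.dimY i : ℂ)) • d.proj i

/-- The commutant `S₀'` of `S₀` in the algebra of all operators. -/
def commutant {n : Type*} [Fintype n] [DecidableEq n]
    (S₀ : StarSubalgebra ℂ (Matrix n n ℂ)) : Set (Matrix n n ℂ) :=
  {X | ∀ K ∈ S₀, K * X = X * K}

end

end WeightedTheta

set_option linter.unusedSectionVars false

open scoped Kronecker ComplexOrder MatrixOrder

namespace WeightedTheta
open Matrix

/-! ### Functional calculus for Hermitian matrices. -/

section Preliminaries

variable {n : Type*} [Fintype n] [DecidableEq n]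

/-! A positive `Y` is the Choi matrix of a completely positive map B ↦ ∑ Yₖ B Yₖ†. In these terms
(`KrausFeasible`), feasibility of λ for θ(S, W) says that the map takes values in S, that ∑ Yₖ†Yₖ ≤
λ, and that |Tr(N√W)|² ≤ ∑ |Tr(N Yₖ)|² for all N.

Inequality: let Y and Z be feasible for (S, V) and (S^⊥ + S₀, W) with values λ and μ, and put C = √V
√D √W and t = Tr(C†C), which equals Tr(V√D W√D). The two domination conditions, used in turn, give
t² ≤ ∑ |Tr(Zₗ† √D Yₖ C)|². This double sum only pairs elements of S with elements of S^⊥ + S₀, and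
in such pairings X ↦ √D X √D may be replaced by X ↦ ∑ wⱼ Fⱼ X Fⱼ†, where the Fⱼ are the matrix units
of S₀' and wⱼ = 1/dim Aᵢ. Indeed both images lie in S, hence pair to zero with S^⊥, and they agree
against S₀ because ∑ wⱼ Fⱼ†Fⱼ = D (`trace_scalar_mul_mul_eq`). As the √wⱼ Fⱼ are orthonormal,
Bessel's inequality bounds the sum by λμt (`sum_norm_trace_sq_le`), so t ≤ λμ.

Equality: Hahn–Banach separation gives a dual optimum (`exists_dual_solution`), namely a completely
positive map with Kraus operators qₖ that is a feasible map for the complementary graph up to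
normalization. Projecting the qₖ to Eₖ in S₀' keeps its values in S^⊥ + S₀, by the bimodule
property, and yields ∑ Eₖ† D⁻¹ Eₖ = E(ρ). Hence Zₖ = D^(-1/2) Eₖ E(ρ)^(-1/2) is feasible with value
1 for every unit combination M = ∑ bₖ Zₖ. Choosing b along the overlaps Tr(qₖ†√V) and setting W =
MM† gives equality by Cauchy–Schwarz (`exists_weight_of_theta_pos`). The other direction follows
because S ↦ S^⊥ + S₀ is an involution on S₀-graphs.

The block decomposition is obtained by splitting off, one at a time, the simple summand generated by
a minimal projection (`exists_tensorBlock`). -/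

lemma continuousOn_real_spectrum (A : Matrix n n ℂ) (f : ℝ → ℝ) :
    ContinuousOn f (spectrum ℝ A) :=
  A.finite_real_spectrum.continuousOn f

lemma trace_mul_nonneg {m : Type*} [Fintype m] {A B : Matrix m m ℂ} (hA : A.PosSemidef)
    (hB : B.PosSemidef) : 0 ≤ (A * B).trace := by
  classical
  obtain ⟨C, rfl⟩ := (CStarAlgebra.nonneg_iff_eq_star_mul_self).mp hA.nonneg
  rw [star_eq_conjTranspose, Matrix.mul_assoc, Matrix.trace_mul_comm]
  simpa [Matrix.mul_assoc] using (hB.mul_mul_conjTranspose_same C).trace_nonneg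

/-- A square root of a positive semidefinite matrix together with its pseudo-inverse. -/
lemma exists_sqrt_pseudoinverse {H : Matrix n n ℂ} (hH : H.PosSemidef) :
    ∃ s t : Matrix n n ℂ, s.PosSemidef ∧ t.IsHermitian ∧ s * s = H ∧ s * t = t * s ∧
      s * t * s = s ∧ t * s * t = t ∧
      ∀ X : Matrix n n ℂ, Commute H X → Commute s X ∧ Commute t X := by
  have hc := continuousOn_real_spectrum H
  have hsa : IsSelfAdjoint H := hH.1
  have hpos : ∀ x ∈ spectrum ℝ H, 0 ≤ x := fun x hx =>
    spectrum_nonneg_of_nonneg hH.nonneg hx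
  refine ⟨cfc (fun x => √x) H, cfc (fun x => (√x)⁻¹) H,
    nonneg_iff_posSemidef.mp (cfc_nonneg fun x _ => Real.sqrt_nonneg x),
    cfc_predicate (R := ℝ) _ H, ?_, (cfc_commute_cfc _ _ H), ?_, ?_, ?_⟩
  · rw [← cfc_mul _ _ H (hc _) (hc _)]
    conv_rhs => rw [← cfc_id ℝ H]
    exact cfc_congr fun x hx => Real.mul_self_sqrt (hpos x hx)
  · rw [← cfc_mul _ _ H (hc _) (hc _), ← cfc_mul _ _ H (hc _) (hc _)]
    exact cfc_congr fun x hx => mul_inv_mul_cancel _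
  · rw [← cfc_mul _ _ H (hc _) (hc _), ← cfc_mul _ _ H (hc _) (hc _)]
    exact cfc_congr fun x hx => by
      by_cases h : √x = 0
      · simp [h]
      · simp [h]
  · intro X hX
    exact ⟨hsa.commute_cfc hX _, hsa.commute_cfc hX _⟩

/-- The projection belongs to a nonzero eigenvalue, so it is a polynomial in `x` without constant
term. The factorization `e = x * y` therefore places it in every algebra containing `x`, even a
non-unital one. -/
lemma exists_spectral_projection {x : Matrix n n ℂ} (hx : x.IsHermitian) (h0 : x ≠ 0) :
    ∃ (l : ℝ) (e y : Matrix n n ℂ), e.IsHermitian ∧ e * e = e ∧ e ≠ 0 ∧ x * e = l • e ∧ e = x * y ∧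
      y ∈ Algebra.adjoin ℝ {x} := by
  have hc := continuousOn_real_spectrum x
  have hsa : IsSelfAdjoint x := hx
  obtain ⟨i, hi⟩ : ∃ i, hx.eigenvalues i ≠ 0 := by
    by_contra! h
    exact h0 (hx.eigenvalues_eq_zero_iff.mp (funext h))
  set l := hx.eigenvalues i with hl
  have hmem : l ∈ spectrum ℝ x := hx.eigenvalues_mem_spectrum_real i
  classical
  -- The value `l⁻¹` at `l` makes `t * q(t)` the indicator of `l` on the spectrum.
  set q := Lagrange.interpolate x.finite_real_spectrum.toFinset id
    (fun t : ℝ => if t = l then l⁻¹ else 0) with hq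
  have hqe : ∀ t ∈ spectrum ℝ x, q.eval t = if t = l then l⁻¹ else 0 := fun t ht => by
    have := Lagrange.eval_interpolate_at_node (s := x.finite_real_spectrum.toFinset) (v := id)
      (fun t : ℝ => if t = l then l⁻¹ else 0) (Set.injOn_id _)
      (by simpa using ht : t ∈ _)
    simpa only [id, hq] using this
  refine ⟨l, cfc (fun t => if t = l then 1 else 0) x, Polynomial.aeval x q,
    cfc_predicate (R := ℝ) _ x, ?_, ?_, ?_, ?_, ?_⟩
  · rw [← cfc_mul _ _ x (hc _) (hc _)]
    congr 1; ext t; simp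
  · intro h
    have h1 : (1 : ℝ) ∈ spectrum ℝ (cfc (fun t : ℝ => if t = l then (1 : ℝ) else 0) x) := by
      rw [cfc_map_spectrum _ x hsa (hc _)]
      exact ⟨l, hmem, by simp⟩
    rw [h] at h1
    have : Nontrivial (Matrix n n ℂ) := ⟨x, 0, h0⟩
    simp [spectrum.zero_eq] at h1
  · have : x * cfc (fun t : ℝ => if t = l then (1 : ℝ) else 0) x =
        cfc (fun t : ℝ => t * if t = l then (1 : ℝ) else 0) x := by
      rw [cfc_mul (fun t => t) _ x (hc _) (hc _), cfc_id' ℝ x]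
    rw [this, ← cfc_const_mul _ _ x (hc _)]
    congr 1; ext t; split_ifs with h <;> simp [h]
  · have : x * Polynomial.aeval x q = cfc (fun t : ℝ => t * q.eval t) x := by
      rw [cfc_mul (fun t => t) _ x (hc _) (hc _), cfc_id' ℝ x, cfc_polynomial q x]
    rw [this]
    refine cfc_congr fun t ht => ?_
    simp only [hqe t ht]
    split_ifs with h
    · rw [h, mul_inv_cancel₀ hi]
    · simp
  · rw [Algebra.adjoin_singleton_eq_range_aeval]
    exact ⟨q, rfl⟩

end Preliminaries
end WeightedTheta

namespace WeightedTheta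
open Matrix

/-! ### Minimal projections in self-adjoint matrix algebras. -/

section Structure

variable {n : Type*} [Fintype n] [DecidableEq n]

/-- The range of `f` lies in that of `e` and has the same dimension, so the ranges coincide. Then
`f` fixes the range of `e`, and taking adjoints finishes. -/
lemma eq_of_rank_eq {e f : Matrix n n ℂ} (he : e.IsHermitian) (hf : f.IsHermitian)
    (hff : f * f = f) (hef : e * f = f) (hr : f.rank = e.rank) : f = e := by
  have hle : LinearMap.range f.mulVecLin ≤ LinearMap.range e.mulVecLin := by
    rw [← hef, Matrix.mulVecLin_mul]
    exact LinearMap.range_comp_le_range _ _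
  have heq := Submodule.eq_of_le_of_finrank_eq hle hr
  have hfe : f * e = e := by
    refine Matrix.ext_of_mulVec_single fun i => ?_
    have : e *ᵥ Pi.single i 1 ∈ LinearMap.range f.mulVecLin := by
      rw [heq]; exact ⟨_, rfl⟩
    obtain ⟨w, hw⟩ := this
    rw [← Matrix.mulVec_mulVec, ← hw, Matrix.mulVecLin_apply, Matrix.mulVec_mulVec, hff]
  have := congrArg conjTranspose hfe
  rw [conjTranspose_mul, he.eq, hf.eq, hef] at this
  exact this

/-- A nonzero self-adjoint matrix algebra contains a projection that compresses it to scalars. -/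
lemma exists_minimal_projection {N : Submodule ℂ (Matrix n n ℂ)}
    (hmul : ∀ x ∈ N, ∀ y ∈ N, x * y ∈ N) (hstar : ∀ x ∈ N, xᴴ ∈ N) (h0 : N ≠ ⊥) :
    ∃ e ∈ N, e.IsHermitian ∧ e * e = e ∧ e ≠ 0 ∧ ∀ x ∈ N, ∃ c : ℂ, e * x * e = c • e := by
  have key : ∀ x ∈ N, x.IsHermitian → x ≠ 0 → ∃ (l : ℝ) (e z : Matrix n n ℂ), e ∈ N ∧
      e.IsHermitian ∧ e * e = e ∧ e ≠ 0 ∧ x * e = l • e ∧ e = x * z := by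
    intro x hx hxh hx0
    obtain ⟨l, e, y, h1, h2, h3, h4, h5, h6⟩ := exists_spectral_projection hxh hx0
    refine ⟨l, e, y, ?_, h1, h2, h3, h4, h5⟩
    rw [h5]
    -- `N` need not contain 1, so `y` itself may lie outside `N`; only multiplication by it
    -- preserves `N`.
    have : ∀ w ∈ N, w * y ∈ N := by
      clear h5
      induction h6 using Algebra.adjoin_induction with
      | mem z hz => rw [Set.mem_singleton_iff.mp hz]; exact fun w hw => hmul w hw x hx
      | algebraMap r =>
        intro w hw
        rw [Algebra.algebraMap_eq_smul_one, Matrix.mul_smul, Matrix.mul_one]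
        exact (N.restrictScalars ℝ).smul_mem r hw
      | add a b _ _ ha hb =>
        intro w hw; rw [Matrix.mul_add]; exact N.add_mem (ha w hw) (hb w hw)
      | mul a b _ _ ha hb =>
        intro w hw; rw [← Matrix.mul_assoc]; exact hb _ (ha w hw)
    exact this x hx
  have hex : ∃ k : ℕ, ∃ e ∈ N, e.IsHermitian ∧ e * e = e ∧ e ≠ 0 ∧ e.rank = k := by
    obtain ⟨x, hx, hx0⟩ := N.ne_bot_iff.mp h0
    obtain ⟨l, e, z, h1, h2, h3, h4, -⟩ := key (xᴴ * x) (hmul _ (hstar x hx) _ hx)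
      (isHermitian_conjTranspose_mul_self x)
      (fun h => hx0 (conjTranspose_mul_self_eq_zero.mp h))
    exact ⟨_, e, h1, h2, h3, h4, rfl⟩
  classical
  -- Least rank is the minimality used: a spectral projection of `e * x * e` lies under `e`, hence
  -- equals it.
  obtain ⟨e, heN, heh, hee, he0, hek⟩ := Nat.find_spec hex
  have hherm : ∀ x ∈ N, x.IsHermitian → ∃ c : ℂ, e * x * e = c • e := by
    intro x hx hxh
    by_cases hy0 : e * x * e = 0
    · exact ⟨0, by simp [hy0]⟩
    obtain ⟨l, f, z, h1, h2, h3, h4, h5, h6⟩ := key (e * x * e) (hmul _ (hmul _ heN _ hx) _ heN)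
      (by simp [IsHermitian, conjTranspose_mul, heh.eq, hxh.eq, Matrix.mul_assoc]) hy0
    have hef : e * f = f := by
      rw [h6]; simp only [← Matrix.mul_assoc, hee]
    have hle : f.rank ≤ e.rank := by rw [← hef]; exact rank_mul_le_left e f
    have hge : e.rank ≤ f.rank := by
      rw [hek]; exact Nat.find_min' hex ⟨f, h1, h2, h3, h4, rfl⟩
    have hfe := eq_of_rank_eq heh h2 h3 hef (le_antisymm hle hge)
    refine ⟨l, ?_⟩
    rw [hfe, Matrix.mul_assoc, hee] at h5
    rw [h5]; ext i j; simp
  refine ⟨e, heN, heh, hee, he0, fun x hx => ?_⟩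
  obtain ⟨a, ha⟩ := hherm (x + xᴴ) (N.add_mem hx (hstar x hx))
    (by simp [IsHermitian, add_comm])
  obtain ⟨b, hb⟩ := hherm (Complex.I • (x - xᴴ))
    (N.smul_mem _ (N.sub_mem hx (hstar x hx)))
    (by ext i j; simp [mul_sub]; ring)
  -- Cartesian decomposition of `x` into its Hermitian parts `x + xᴴ` and `i(x - xᴴ)`.
  refine ⟨(a - Complex.I * b) / 2, ?_⟩
  have hx2 : x = (1 / 2 : ℂ) • ((x + xᴴ) - Complex.I • (Complex.I • (x - xᴴ))) := by
    rw [smul_smul, Complex.I_mul_I]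
    ext i j; simp; ring
  conv_lhs => rw [hx2]
  rw [Matrix.mul_smul, Matrix.smul_mul, Matrix.mul_sub, Matrix.sub_mul, ha, Matrix.mul_smul,
    Matrix.smul_mul, hb, smul_smul, ← sub_smul, smul_smul]
  congr 1; ring

lemma exists_isometry_of_projection {e : Matrix n n ℂ} (he : e.IsHermitian) (hee : e * e = e)
    (h0 : e ≠ 0) : ∃ (m : ℕ) (Y : Matrix n (Fin m) ℂ), 0 < m ∧ Yᴴ * Y = 1 ∧ Y * Yᴴ = e := by
  let R : Submodule ℂ (EuclideanSpace ℂ n) := LinearMap.range (toEuclideanLin e)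
  let b := stdOrthonormalBasis ℂ R
  let Y : Matrix n (Fin (Module.finrank ℂ R)) ℂ := of fun i j => (b j : EuclideanSpace ℂ n) i
  have hYY : Yᴴ * Y = 1 := by
    ext j k
    have := orthonormal_iff_ite.mp b.orthonormal j k
    rw [Submodule.coe_inner, EuclideanSpace.inner_eq_star_dotProduct, dotProduct_comm] at this
    rw [Matrix.one_apply, ← this]
    rfl
  have heY : e * Y = Y := by
    ext i j
    obtain ⟨w, hw⟩ := (b j).2
    have h1 : toEuclideanLin e (b j : EuclideanSpace ℂ n) = b j := by
      rw [← hw]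
      simp [toLpLin_apply, Matrix.mulVec_mulVec, hee]
    exact congrFun (congrArg WithLp.ofLp h1) i
  have hYe : Y * Yᴴ * e = e := by
    refine Matrix.ext_of_mulVec_single fun k => ?_
    let v : R := ⟨toEuclideanLin e (WithLp.toLp 2 (Pi.single k 1)), ⟨_, rfl⟩⟩
    have h1 := congrArg (fun w : R => (w : EuclideanSpace ℂ n).ofLp) (b.sum_repr' v)
    have h2 : (v : EuclideanSpace ℂ n).ofLp = e *ᵥ Pi.single k 1 := by
      simp [v, toLpLin_apply]
    simp only [h2] at h1
    rw [← Matrix.mulVec_mulVec, ← Matrix.mulVec_mulVec]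
    conv_rhs => rw [← h1]
    ext i
    simp only [Submodule.coe_inner, EuclideanSpace.inner_eq_star_dotProduct, h2]
    simp [Matrix.mulVec, dotProduct, Y, mul_comm]
  have hYe' : Y * Yᴴ = e := by
    have := congrArg conjTranspose heY
    rw [conjTranspose_mul, he.eq] at this
    rw [← hYe, Matrix.mul_assoc, this]
  refine ⟨_, Y, Nat.pos_of_ne_zero fun hm => h0 ?_, hYY, hYe'⟩
  rw [← hYe']
  ext i j
  have : IsEmpty (Fin (Module.finrank ℂ R)) := by rw [hm]; infer_instance
  simp [Matrix.mul_apply]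

end Structure
end WeightedTheta

namespace WeightedTheta
open Matrix

/-! ### Existence of the block decomposition. -/

section Blocks

variable {n : Type*} [Fintype n] [DecidableEq n]

/-- An isometric embedding of a tensor product space `ℂᵃ ⊗ ℂʸ` into `ℂⁿ`. -/
structure TensorBlock (n : Type*) [Fintype n] where
  a : ℕ
  y : ℕ
  a_pos : 0 < a
  y_pos : 0 < y
  V : Matrix n (Fin a × Fin y) ℂ
  isometry : V.conjTranspose * V = 1

/-- The embedding `M ↦ V (M ⊗ I) V†` of the first tensor factor's operators. -/
noncomputable def TensorBlock.emb (b : TensorBlock n) :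
    Matrix (Fin b.a) (Fin b.a) ℂ →ₗ[ℂ] Matrix n n ℂ where
  toFun M := b.V * (M ⊗ₖ (1 : Matrix (Fin b.y) (Fin b.y) ℂ)) * b.Vᴴ
  map_add' M M' := by rw [add_kronecker, Matrix.mul_add, Matrix.add_mul]
  map_smul' c M := by simp [smul_kronecker]

lemma stack_mul_kronecker_one_mul {a m : Type*} [Fintype a] [DecidableEq a] [Fintype m]
    [DecidableEq m] (Z : a → Matrix n m ℂ) (M : Matrix a a ℂ) :
    (of fun i (p : a × m) => Z p.1 i p.2) * (M ⊗ₖ (1 : Matrix m m ℂ)) *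
      (of fun i (p : a × m) => Z p.1 i p.2)ᴴ = ∑ b, ∑ c, M b c • (Z b * (Z c)ᴴ) := by
  ext i j
  simp only [Matrix.mul_apply, Matrix.sum_apply, Matrix.smul_apply, conjTranspose_apply, of_apply,
    kroneckerMap_apply, Matrix.one_apply, Fintype.sum_prod_type, smul_eq_mul, mul_ite, mul_one,
    mul_zero, Finset.sum_ite_eq', Finset.mem_univ, if_true, Finset.sum_mul, Finset.mul_sum]
  conv_rhs => rw [Finset.sum_comm]
  refine Finset.sum_congr rfl fun c _ => ?_
  rw [Finset.sum_comm]
  exact Finset.sum_congr rfl fun b _ => Finset.sum_congr rfl fun y _ => by ring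

/-- For a minimal projection `e = Y Yᴴ`, the left ideal `N e` is a Hilbert space, since `xᴴ y` is a
scalar multiple of `e` for `x, y` in it. With an orthonormal basis `x a`, the products `x a * (x
a')ᴴ` are matrix units in `N`, and the columns of the `x a * Y` form the isometry. Left
multiplication by `N` preserves the ideal, which gives the last claim. -/
lemma exists_tensorBlock {N : Submodule ℂ (Matrix n n ℂ)}
    (hmul : ∀ x ∈ N, ∀ y ∈ N, x * y ∈ N) (hstar : ∀ x ∈ N, xᴴ ∈ N) (h0 : N ≠ ⊥) :
    ∃ b : TensorBlock n, LinearMap.range b.emb ≤ N ∧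
      ∀ s ∈ N, s * (b.V * b.Vᴴ) ∈ LinearMap.range b.emb := by
  obtain ⟨e, heN, heh, hee, he0, hmin⟩ := exists_minimal_projection hmul hstar h0
  obtain ⟨m, Y, hm, hYY, hYe⟩ := exists_isometry_of_projection heh hee he0
  let j0 : Fin m := ⟨0, hm⟩
  have heY : e * Y = Y := by rw [← hYe, Matrix.mul_assoc, hYY, Matrix.mul_one]
  let L : Submodule ℂ (Matrix n n ℂ) := N ⊓ LinearMap.ker (LinearMap.mulRight ℂ e - LinearMap.id)
  have hL : ∀ x, x ∈ L ↔ x ∈ N ∧ x * e = x := fun x => by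
    simp [L, sub_eq_zero]
  -- The action on a single column of `Y` already carries the scalar-valued inner product of the
  -- ideal.
  let φ : Matrix n n ℂ →ₗ[ℂ] EuclideanSpace ℂ n :=
    { toFun := fun x => WithLp.toLp 2 (x *ᵥ Y.col j0)
      map_add' := fun x y => by rw [Matrix.add_mulVec]; rfl
      map_smul' := fun c x => by rw [Matrix.smul_mulVec]; rfl }
  have hinner : ∀ x ∈ L, ∀ y ∈ L, (x * Y)ᴴ * (y * Y) =
      (inner ℂ (φ x) (φ y)) • (1 : Matrix (Fin m) (Fin m) ℂ) := by
    intro x hx y hy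
    rw [hL] at hx hy
    obtain ⟨c, hc⟩ := hmin (xᴴ * y) (hmul _ (hstar x hx.1) _ hy.1)
    have h1 : (x * Y)ᴴ * (y * Y) = c • (1 : Matrix (Fin m) (Fin m) ℂ) := by
      have h2 : e * xᴴ = xᴴ := by
        have := congrArg conjTranspose hx.2
        rwa [conjTranspose_mul, heh.eq] at this
      have h3 : xᴴ * y = c • e := by
        rw [← hc]; simp only [← Matrix.mul_assoc, h2]; rw [Matrix.mul_assoc, hy.2]
      rw [conjTranspose_mul, Matrix.mul_assoc, ← Matrix.mul_assoc xᴴ, h3, Matrix.smul_mul, heY,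
        Matrix.mul_smul, hYY]
    have h2 : inner ℂ (φ x) (φ y) = c := by
      have := congrFun (congrFun h1 j0) j0
      rw [EuclideanSpace.inner_eq_star_dotProduct, dotProduct_comm]
      simp only [Matrix.smul_apply, Matrix.one_apply_eq, smul_eq_mul, mul_one] at this
      rw [← this]; rfl
    rw [h1, h2]
  have hinj : ∀ x ∈ L, φ x = 0 → x = 0 := by
    intro x hx h
    have h1 := hinner x hx x hx
    rw [h, inner_zero_left, zero_smul, conjTranspose_mul_self_eq_zero] at h1
    rw [← ((hL x).mp hx).2, ← hYe, ← Matrix.mul_assoc, h1, Matrix.zero_mul]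
  let b := stdOrthonormalBasis ℂ (L.map φ)
  have hb : ∀ a, ∃ x ∈ L, φ x = b a := fun a => (b a).2
  choose x hxL hxb using hb
  have hxx : ∀ a a', (x a * Y)ᴴ * (x a' * Y) =
      (if a = a' then (1 : ℂ) else 0) • (1 : Matrix (Fin m) (Fin m) ℂ) := by
    intro a a'
    rw [hinner _ (hxL a) _ (hxL a'), hxb, hxb, ← Submodule.coe_inner,
      orthonormal_iff_ite.mp b.orthonormal]
  have hdim : 0 < Module.finrank ℂ (L.map φ) := by
    have hne : (⟨φ e, e, (hL e).mpr ⟨heN, hee⟩, rfl⟩ : L.map φ) ≠ 0 := by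
      intro h
      exact he0 (hinj e ((hL e).mpr ⟨heN, hee⟩) (congrArg Subtype.val h))
    have : Nontrivial (L.map φ) := ⟨_, _, hne⟩
    exact Module.finrank_pos
  have hV : (of fun i (p : Fin (Module.finrank ℂ (L.map φ)) × Fin m) => (x p.1 * Y) i p.2)ᴴ *
      (of fun i (p : Fin (Module.finrank ℂ (L.map φ)) × Fin m) => (x p.1 * Y) i p.2) = 1 := by
    ext p q
    refine (congrFun (congrFun (hxx p.1 q.1) p.2) q.2).trans ?_
    rcases p with ⟨a, i⟩
    rcases q with ⟨a', j⟩
    by_cases h1 : a = a' <;> by_cases h2 : i = j <;> simp [Matrix.one_apply, h1, h2]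
  let B : TensorBlock n := ⟨_, m, hdim, hm, _, hV⟩
  have hemb : ∀ M, B.emb M = ∑ a, ∑ a', M a a' • (x a * (x a')ᴴ) := by
    intro M
    have hx' : ∀ a a', x a * (x a')ᴴ = (x a * Y) * (x a' * Y)ᴴ := by
      intro a a'
      rw [conjTranspose_mul, Matrix.mul_assoc, ← Matrix.mul_assoc Y, hYe, ← Matrix.mul_assoc,
        ((hL _).mp (hxL a)).2]
    simp only [hx']
    exact stack_mul_kronecker_one_mul (fun a => x a * Y) M
  refine ⟨B, ?_, ?_⟩
  · rintro _ ⟨M, rfl⟩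
    rw [hemb]
    exact N.sum_mem fun a _ => N.sum_mem fun a' _ => N.smul_mem _
      (hmul _ ((hL _).mp (hxL a)).1 _ (hstar _ ((hL _).mp (hxL a')).1))
  · intro s hs
    have hP : B.V * B.Vᴴ = ∑ a, x a * (x a)ᴴ := by
      have := hemb 1
      simp only [TensorBlock.emb, LinearMap.coe_mk, AddHom.coe_mk, one_kronecker_one,
        Matrix.mul_one, Matrix.one_apply, ite_smul, one_smul, zero_smul, Finset.sum_ite_eq,
        Finset.mem_univ, if_true] at this
      exact this
    have hs' : ∀ a, ∃ c : Fin (Module.finrank ℂ (L.map φ)) → ℂ, s * x a = ∑ a', c a' • x a' := by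
      intro a
      have hsL : s * x a ∈ L := by
        have := (hL _).mp (hxL a)
        exact (hL _).mpr ⟨hmul _ hs _ this.1, by rw [Matrix.mul_assoc, this.2]⟩
      have h1 := congrArg Subtype.val (b.sum_repr ⟨φ (s * x a), _, hsL, rfl⟩)
      refine ⟨fun a' => b.repr ⟨φ (s * x a), _, hsL, rfl⟩ a', sub_eq_zero.mp (hinj _ ?_ ?_)⟩
      · exact L.sub_mem hsL (L.sum_mem fun a' _ => L.smul_mem _ (hxL a'))
      · rw [map_sub, map_sum, sub_eq_zero]
        refine h1.symm.trans ?_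
        simp [hxb]
    choose c hc using hs'
    refine ⟨of fun a a' => c a' a, ?_⟩
    rw [hemb, hP, Matrix.mul_sum, Finset.sum_comm]
    refine Finset.sum_congr rfl fun a _ => ?_
    rw [← Matrix.mul_assoc, hc, Finset.sum_mul]
    simp only [of_apply, Matrix.smul_mul]
    rfl

/-- A self-adjoint matrix algebra is a sum of pairwise orthogonal tensor blocks. -/
lemma exists_tensorBlocks (k : ℕ) : ∀ {N : Submodule ℂ (Matrix n n ℂ)},
    (∀ x ∈ N, ∀ y ∈ N, x * y ∈ N) → (∀ x ∈ N, xᴴ ∈ N) → Module.finrank ℂ N ≤ k →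
    ∃ (r : ℕ) (B : Fin r → TensorBlock n), (∀ i j, i ≠ j → (B i).Vᴴ * (B j).V = 0) ∧
      N = ⨆ i, LinearMap.range (B i).emb := by
  induction k with
  | zero =>
    intro N _ _ h
    refine ⟨0, Fin.elim0, fun i => i.elim0, ?_⟩
    rw [iSup_of_empty, ← Submodule.finrank_eq_zero (R := ℂ)]
    omega
  | succ k ih =>
    intro N hmul hstar hk
    by_cases h0 : N = ⊥
    · exact ⟨0, Fin.elim0, fun i => i.elim0, by rw [iSup_of_empty, h0]⟩
    obtain ⟨b, hbN, hbs⟩ := exists_tensorBlock hmul hstar h0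
    set P := b.V * b.Vᴴ with hP
    have hPh : Pᴴ = P := by simp [hP]
    have hVP : b.Vᴴ * P = b.Vᴴ := by rw [hP, ← Matrix.mul_assoc, b.isometry, Matrix.one_mul]
    have hPV : P * b.V = b.V := by rw [hP, Matrix.mul_assoc, b.isometry, Matrix.mul_one]
    have hPP : P * P = P := by
      conv_lhs => rw [hP]
      rw [Matrix.mul_assoc, hVP]
    have hPe : ∀ M, P * b.emb M = b.emb M := fun M => by
      simp only [TensorBlock.emb, LinearMap.coe_mk, AddHom.coe_mk, ← Matrix.mul_assoc, hPV]
    have heP : ∀ M, b.emb M * P = b.emb M := fun M => by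
      simp only [TensorBlock.emb, LinearMap.coe_mk, AddHom.coe_mk, Matrix.mul_assoc, hVP]
    have hPN : P ∈ N := hbN ⟨1, by simp [TensorBlock.emb, hP]⟩
    have hPsP : ∀ s ∈ N, P * s * P = s * P := fun s hs => by
      obtain ⟨M, hM⟩ := hbs s hs
      rw [Matrix.mul_assoc, ← hM, hPe]
    -- `P s P = s P` for both `s` and `sᴴ` makes `P` central in `N`, so the remainder `N'` is again
    -- a self-adjoint algebra, of smaller dimension.
    have hcomm : ∀ s ∈ N, P * s = s * P := fun s hs => by
      have := congrArg conjTranspose (hPsP _ (hstar s hs))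
      simp only [conjTranspose_mul, hPh, conjTranspose_conjTranspose] at this
      rw [← this, ← Matrix.mul_assoc, hPsP s hs]
    let N' : Submodule ℂ (Matrix n n ℂ) := N ⊓ LinearMap.ker (LinearMap.mulRight ℂ P)
    have hN' : ∀ s, s ∈ N' ↔ s ∈ N ∧ s * P = 0 := fun s => by simp [N']
    have hP0 : P ≠ 0 := by
      intro h
      have h1 : b.Vᴴ * P * b.V = 1 := by rw [hVP, b.isometry]
      rw [h, Matrix.mul_zero, Matrix.zero_mul] at h1
      have := congrFun (congrFun h1 (⟨0, b.a_pos⟩, ⟨0, b.y_pos⟩)) (⟨0, b.a_pos⟩, ⟨0, b.y_pos⟩)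
      simp at this
    have hlt : N' < N := lt_of_le_of_ne inf_le_left fun h => by
      have : P ∈ N' := h ▸ hPN
      exact hP0 (by rw [← hPP]; exact ((hN' P).mp this).2)
    obtain ⟨r, B, hB, hBN⟩ := @ih N'
      (fun s hs t ht => by
        rw [hN'] at *
        exact ⟨hmul _ hs.1 _ ht.1, by rw [Matrix.mul_assoc, ht.2, Matrix.mul_zero]⟩)
      (fun s hs => by
        rw [hN'] at *
        refine ⟨hstar _ hs.1, ?_⟩
        have := congrArg conjTranspose ((hcomm s hs.1).trans hs.2)
        rwa [conjTranspose_mul, hPh, conjTranspose_zero] at this)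
      (by have := Submodule.finrank_lt_finrank_of_lt hlt; omega)
    have hort : ∀ i, (B i).Vᴴ * b.V = 0 := by
      intro i
      have h1 : (B i).V * (B i).Vᴴ ∈ N' := by
        rw [hBN]
        exact Submodule.mem_iSup_of_mem i ⟨1, by simp [TensorBlock.emb]⟩
      have h2 := ((hN' _).mp h1).2
      calc (B i).Vᴴ * b.V = (B i).Vᴴ * ((B i).V * (B i).Vᴴ * P) * b.V := by
            rw [Matrix.mul_assoc, Matrix.mul_assoc _ P, hPV, ← Matrix.mul_assoc,
              ← Matrix.mul_assoc, (B i).isometry, Matrix.one_mul]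
        _ = 0 := by rw [h2, Matrix.mul_zero, Matrix.zero_mul]
    refine ⟨r + 1, Fin.cons b B, ?_, ?_⟩
    · intro i j
      refine Fin.cases ?_ (fun i => ?_) i <;> refine Fin.cases ?_ (fun j => ?_) j
      · exact fun h => (h rfl).elim
      · intro _
        have := congrArg conjTranspose (hort j)
        rwa [conjTranspose_mul, conjTranspose_conjTranspose, conjTranspose_zero] at this
      · exact fun _ => hort i
      · exact fun h => hB i j fun hij => h (by rw [hij])
    · have hsup : N = LinearMap.range b.emb ⊔ N' := by
        refine le_antisymm (fun s hs => ?_) (sup_le hbN inf_le_left)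
        rw [← add_sub_cancel (s * P) s]
        refine Submodule.add_mem_sup (hbs s hs) ((hN' _).mpr ⟨N.sub_mem hs (hmul _ hs _ hPN), ?_⟩)
        rw [Matrix.sub_mul, Matrix.mul_assoc, hPP, sub_self]
      rw [hsup, hBN]
      refine le_antisymm (sup_le ?_ (iSup_le fun i => ?_)) (iSup_le fun i => ?_)
      · exact le_iSup (fun i => LinearMap.range ((Fin.cons b B : Fin (r + 1) → TensorBlock n) i).emb) 0
      · exact le_iSup (fun i => LinearMap.range ((Fin.cons b B : Fin (r + 1) → TensorBlock n) i).emb) i.succ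
      · refine Fin.cases ?_ (fun i => ?_) i
        · exact le_sup_left
        · exact le_sup_of_le_right (le_iSup (fun i => LinearMap.range (B i).emb) i)

/-- Conjugating a block diagonal matrix splits into a sum over the blocks. -/
lemma mul_blockDiagonal'_mul {ι l : Type*} [Fintype ι] [DecidableEq ι] {p : ι → Type*}
    [∀ i, Fintype (p i)] (U : Matrix l (Σ i, p i) ℂ) (F : ∀ i, Matrix (p i) (p i) ℂ) :
    U * blockDiagonal' F * Uᴴ =
      ∑ i, U.submatrix id (Sigma.mk i) * F i * (U.submatrix id (Sigma.mk i))ᴴ := by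
  have h : ∀ i k x, (U * blockDiagonal' F) i ⟨k, x⟩ = (U.submatrix id (Sigma.mk k) * F k) i x := by
    intro i k x
    rw [Matrix.mul_apply, Fintype.sum_sigma, Finset.sum_eq_single k]
    · simp [Matrix.mul_apply, blockDiagonal'_apply]
    · intro j _ hj
      simp [blockDiagonal'_apply, hj]
    · simp
  ext i j
  rw [Matrix.mul_apply, Fintype.sum_sigma, Matrix.sum_apply]
  refine Finset.sum_congr rfl fun k _ => ?_
  simp only [h]
  rw [Matrix.mul_apply]
  rfl

lemma nonempty_blockDecomposition (S₀ : StarSubalgebra ℂ (Matrix n n ℂ)) :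
    Nonempty (BlockDecomposition S₀) := by
  obtain ⟨r, B, hB, hN⟩ := exists_tensorBlocks _ (N := vertexSpace S₀)
    (fun x hx y hy => S₀.mul_mem hx hy) (fun x hx => S₀.star_mem' hx) le_rfl
  let U : Matrix n (Σ i : Fin r, Fin (B i).a × Fin (B i).y) ℂ := of fun i k => (B k.1).V i k.2
  have hUV : ∀ i, U.submatrix id (Sigma.mk i) = (B i).V := fun i => rfl
  have hmem : ∀ X : Matrix n n ℂ, X ∈ S₀ ↔
      ∃ M : (i : Fin r) → Matrix (Fin (B i).a) (Fin (B i).a) ℂ,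
      X = U * (Matrix.blockDiagonal'
        (fun i => M i ⊗ₖ (1 : Matrix (Fin (B i).y) (Fin (B i).y) ℂ)) :
          Matrix (Σ i : Fin r, Fin (B i).a × Fin (B i).y)
            (Σ i : Fin r, Fin (B i).a × Fin (B i).y) ℂ) * U.conjTranspose := by
    intro X
    have h1 : X ∈ S₀ ↔ X ∈ ⨆ i, LinearMap.range (B i).emb := by rw [← hN]; rfl
    rw [h1, Submodule.mem_iSup_iff_exists_finsupp]
    constructor
    · rintro ⟨f, hf, rfl⟩
      choose M hM using hf
      refine ⟨M, ?_⟩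
      rw [mul_blockDiagonal'_mul, Finsupp.sum_fintype _ _ fun _ => rfl]
      exact Finset.sum_congr rfl fun i _ => (hM i).symm
    · rintro ⟨M, rfl⟩
      refine ⟨Finsupp.equivFunOnFinite.symm fun i => (B i).emb (M i), fun i => ⟨M i, rfl⟩, ?_⟩
      rw [mul_blockDiagonal'_mul, Finsupp.sum_fintype _ _ fun _ => rfl]
      rfl
  have hUU : Uᴴ * U = 1 := by
    ext ⟨i, p⟩ ⟨j, q⟩
    have h1 : (Uᴴ * U) ⟨i, p⟩ ⟨j, q⟩ = ((B i).Vᴴ * (B j).V) p q := rfl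
    rw [h1]
    by_cases hij : i = j
    · subst hij
      rw [(B i).isometry, Matrix.one_apply, Matrix.one_apply]
      simp
    · rw [hB i j hij, Matrix.one_apply, if_neg (by simp [hij])]
      rfl
  refine ⟨⟨r, fun i => (B i).a, fun i => (B i).y, fun i => (B i).a_pos, fun i => (B i).y_pos,
    U, hUU, ?_, hmem⟩⟩
  -- The blocks fill the whole space because `S₀` is unital: 1 has the form `U * _ * Uᴴ`, which `U *
  -- Uᴴ` fixes from the left.
  obtain ⟨M, hM⟩ := (hmem 1).mp (one_mem S₀)
  calc U * Uᴴ = U * Uᴴ * 1 := (Matrix.mul_one _).symm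
    _ = 1 := by
      conv_lhs => rw [hM]
      rw [← Matrix.mul_assoc, Matrix.mul_assoc U, ← Matrix.mul_assoc Uᴴ, hUU, Matrix.one_mul, ← hM]

end Blocks
end WeightedTheta

namespace WeightedTheta
open Matrix

/-! ### Hilbert–Schmidt complements and the involution on S₀-graphs. -/

section Graphs

variable {n : Type*} [Fintype n]

/-- Vectorization as a linear equivalence onto a Euclidean space. -/
noncomputable def vecEquiv (n : Type*) [Fintype n] :
    Matrix n n ℂ ≃ₗ[ℂ] EuclideanSpace ℂ (n × n) :=
  LinearEquiv.ofBijective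
    { toFun := fun X => WithLp.toLp 2 X.vec
      map_add' := fun _ _ => rfl
      map_smul' := fun _ _ => rfl }
    ⟨fun _ _ h => vec_inj.mp (congrArg WithLp.ofLp h), fun v =>
      ⟨of fun i j => v (j, i), rfl⟩⟩

lemma inner_vecEquiv (X Y : Matrix n n ℂ) :
    inner ℂ (vecEquiv n X) (vecEquiv n Y) = (Xᴴ * Y).trace := by
  rw [EuclideanSpace.inner_eq_star_dotProduct, dotProduct_comm]
  exact star_vec_dotProduct_vec X Y

lemma norm_vecEquiv_sq (X : Matrix n n ℂ) :
    ((‖vecEquiv n X‖ ^ 2 : ℝ) : ℂ) = (Xᴴ * X).trace := by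
  rw [← inner_vecEquiv, inner_self_eq_norm_sq_to_K]
  simp

lemma mem_hsOrthogonal {S : Submodule ℂ (Matrix n n ℂ)} {X : Matrix n n ℂ} :
    X ∈ hsOrthogonal S ↔ ∀ Y ∈ S, (Yᴴ * X).trace = 0 := Iff.rfl

lemma map_hsOrthogonal (S : Submodule ℂ (Matrix n n ℂ)) :
    (hsOrthogonal S).map (vecEquiv n).toLinearMap = (S.map (vecEquiv n).toLinearMap)ᗮ := by
  ext v
  obtain ⟨X, rfl⟩ := (vecEquiv n).surjective v
  rw [Submodule.mem_orthogonal]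
  simp only [Submodule.mem_map, LinearEquiv.coe_coe, EmbeddingLike.apply_eq_iff_eq,
    exists_eq_right, mem_hsOrthogonal, forall_exists_index, and_imp, forall_apply_eq_imp_iff₂,
    inner_vecEquiv]

lemma map_vecEquiv_injective :
    Function.Injective (Submodule.map (vecEquiv n).toLinearMap) :=
  Submodule.map_injective_of_injective (vecEquiv n).injective

lemma hsOrthogonal_hsOrthogonal (S : Submodule ℂ (Matrix n n ℂ)) :
    hsOrthogonal (hsOrthogonal S) = S :=
  map_vecEquiv_injective (by rw [map_hsOrthogonal, map_hsOrthogonal,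
    Submodule.orthogonal_orthogonal])

lemma hsOrthogonal_sup (S T : Submodule ℂ (Matrix n n ℂ)) :
    hsOrthogonal (S ⊔ T) = hsOrthogonal S ⊓ hsOrthogonal T := by
  apply map_vecEquiv_injective
  rw [Submodule.map_inf _ (vecEquiv n).injective, map_hsOrthogonal, map_hsOrthogonal,
    map_hsOrthogonal, Submodule.map_sup, Submodule.inf_orthogonal]

lemma sup_hsOrthogonal_inf {S T : Submodule ℂ (Matrix n n ℂ)} (h : S ≤ T) :
    S ⊔ hsOrthogonal S ⊓ T = T := by
  apply map_vecEquiv_injective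
  rw [Submodule.map_sup, Submodule.map_inf _ (vecEquiv n).injective, map_hsOrthogonal]
  exact Submodule.sup_orthogonal_inf_of_hasOrthogonalProjection (Submodule.map_mono h)

variable [DecidableEq n] {S₀ : StarSubalgebra ℂ (Matrix n n ℂ)} {S : Submodule ℂ (Matrix n n ℂ)}

lemma mem_vertexSpace {X : Matrix n n ℂ} : X ∈ vertexSpace S₀ ↔ X ∈ S₀ := Iff.rfl

lemma conjTranspose_mem_algebra {X : Matrix n n ℂ} (hX : X ∈ S₀) : Xᴴ ∈ S₀ := star_mem hX

lemma IsGraphOver.mul_mul_mem (hS : IsGraphOver S₀ S) {a X b : Matrix n n ℂ} (ha : a ∈ S₀)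
    (hX : X ∈ S) (hb : b ∈ S₀) : a * X * b ∈ S := by
  rw [← hS.bimodule]
  exact Submodule.mul_mem_mul (Submodule.mul_mem_mul (mem_vertexSpace.mpr ha) hX)
    (mem_vertexSpace.mpr hb)

lemma IsGraphOver.mul_mul_mem_hsOrthogonal (hS : IsGraphOver S₀ S) {a X b : Matrix n n ℂ}
    (ha : a ∈ S₀) (hX : X ∈ hsOrthogonal S) (hb : b ∈ S₀) : a * X * b ∈ hsOrthogonal S := by
  intro Y hY
  have := hX _ (hS.mul_mul_mem (conjTranspose_mem_algebra ha) hY (conjTranspose_mem_algebra hb))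
  rw [← this, conjTranspose_mul, conjTranspose_mul, conjTranspose_conjTranspose,
    conjTranspose_conjTranspose, ← Matrix.mul_assoc, Matrix.trace_mul_comm]
  simp only [Matrix.mul_assoc]

lemma IsGraphOver.conjTranspose_mem_hsOrthogonal (hS : IsGraphOver S₀ S) {X : Matrix n n ℂ}
    (hX : X ∈ hsOrthogonal S) : Xᴴ ∈ hsOrthogonal S := by
  intro Y hY
  have := hX _ (hS.isNCGraph.conjTranspose_mem _ hY)
  rw [conjTranspose_conjTranspose] at this
  rw [← conjTranspose_mul, trace_conjTranspose, Matrix.trace_mul_comm, this, star_zero]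

lemma IsGraphOver.graphCompl (hS : IsGraphOver S₀ S) : IsGraphOver S₀ (graphCompl S₀ S) := by
  have h1 : (1 : Matrix n n ℂ) ∈ S₀ := one_mem S₀
  have hle : vertexSpace S₀ ≤ WeightedTheta.graphCompl S₀ S := le_sup_right
  refine ⟨⟨fun X hX => ?_, hle h1⟩, hle, le_antisymm ?_ fun X hX => ?_⟩
  · obtain ⟨Y, hY, Z, hZ, rfl⟩ := Submodule.mem_sup.mp hX
    rw [conjTranspose_add]
    exact Submodule.add_mem_sup (hS.conjTranspose_mem_hsOrthogonal hY)
      (conjTranspose_mem_algebra hZ)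
  · refine Submodule.mul_le.mpr fun Y hY b hb => ?_
    induction hY using Submodule.mul_induction_on' with
    | mem_mul_mem a ha X hX =>
      obtain ⟨Y, hY, Z, hZ, rfl⟩ := Submodule.mem_sup.mp hX
      rw [Matrix.mul_add, Matrix.add_mul]
      exact Submodule.add_mem_sup (hS.mul_mul_mem_hsOrthogonal ha hY hb)
        (S₀.mul_mem (S₀.mul_mem ha hZ) hb)
    | add x _ y _ hx hy =>
      rw [Matrix.add_mul]
      exact Submodule.add_mem _ hx hy
  · have := Submodule.mul_mem_mul (Submodule.mul_mem_mul (mem_vertexSpace.mpr h1) hX)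
      (mem_vertexSpace.mpr h1)
    rwa [Matrix.one_mul, Matrix.mul_one] at this

/-- (S^⊥ + S₀)^⊥ + S₀ = (S ∩ S₀^⊥) + S₀, which is S because S₀ ≤ S. -/
lemma IsGraphOver.graphCompl_graphCompl (hS : IsGraphOver S₀ S) :
    WeightedTheta.graphCompl S₀ (WeightedTheta.graphCompl S₀ S) = S := by
  rw [WeightedTheta.graphCompl, WeightedTheta.graphCompl, hsOrthogonal_sup,
    hsOrthogonal_hsOrthogonal, inf_comm, sup_comm]
  exact sup_hsOrthogonal_inf hS.vertexSpace_le

end Graphs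
end WeightedTheta

namespace WeightedTheta
open Matrix

/-! ### The theta program in terms of Kraus operators. -/

section Kraus

variable {n : Type*} [Fintype n] [DecidableEq n]

/-- The block of `Y` at the basis elements `b`, `b'` of the second factor. -/
def tensorSlice (b b' : n) : Matrix (n × n) (n × n) ℂ →ₗ[ℂ] Matrix n n ℂ where
  toFun Y := of fun a a' => Y (a, b) (a', b')
  map_add' _ _ := rfl
  map_smul' _ _ := rfl

lemma tensorSlice_apply (b b' : n) (Y : Matrix (n × n) (n × n) ℂ) (a a' : n) :
    tensorSlice b b' Y a a' = Y (a, b) (a', b') := rfl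

lemma mem_tensorFull {S : Submodule ℂ (Matrix n n ℂ)} {Y : Matrix (n × n) (n × n) ℂ} :
    Y ∈ tensorFull S ↔ ∀ b b', tensorSlice b b' Y ∈ S := by
  constructor
  · intro hY b b'
    have : tensorFull S ≤ S.comap (tensorSlice b b') := by
      refine Submodule.span_le.mpr ?_
      rintro _ ⟨X, hX, Z, rfl⟩
      have : tensorSlice b b' (X ⊗ₖ Z) = Z b b' • X := by
        ext i j; simp [tensorSlice_apply, mul_comm]
      simpa [this] using S.smul_mem _ hX
    exact this hY
  · intro h
    have : Y = ∑ b, ∑ b', tensorSlice b b' Y ⊗ₖ single b b' (1 : ℂ) := by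
      ext ⟨a, c⟩ ⟨a', c'⟩
      simp [Matrix.sum_apply, tensorSlice_apply, Matrix.single_apply, ite_and]
    rw [this]
    exact Submodule.sum_mem _ fun b _ => Submodule.sum_mem _ fun b' _ =>
      Submodule.subset_span ⟨_, h b b', _, rfl⟩

lemma vectorize_apply (M : Matrix n n ℂ) (p : n × n) : vectorize M p = M p.1 p.2 := by
  obtain ⟨a, b⟩ := p
  simp [vectorize, mulVec, dotProduct, maxEntangled, Fintype.sum_prod_type, Matrix.one_apply]

/-- The Choi matrix of the completely positive map with the given Kraus operators. -/
def choi {ι : Type*} [Fintype ι] (Y : ι → Matrix n n ℂ) : Matrix (n × n) (n × n) ℂ :=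
  ∑ k, ketBra (fun p => Y k p.1 p.2)

lemma choi_apply {ι : Type*} [Fintype ι] (Y : ι → Matrix n n ℂ) (p q : n × n) :
    choi Y p q = ∑ k, Y k p.1 p.2 * star (Y k q.1 q.2) := by
  simp [choi, Matrix.sum_apply, ketBra, vecMulVec_apply]

lemma exists_choi_eq {Y : Matrix (n × n) (n × n) ℂ} (hY : Y.PosSemidef) :
    ∃ (m : ℕ) (K : Fin m → Matrix n n ℂ), choi K = Y := by
  obtain ⟨m, v, rfl⟩ := posSemidef_iff_eq_sum_vecMulVec.mp hY
  exact ⟨m, fun k => of fun a b => v k (a, b), rfl⟩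

lemma tensorSlice_choi {ι : Type*} [Fintype ι] (Y : ι → Matrix n n ℂ) (b b' : n) :
    tensorSlice b b' (choi Y) = ∑ k, Y k * single b b' 1 * (Y k)ᴴ := by
  ext i j
  simp only [tensorSlice_apply, choi_apply, Matrix.sum_apply]
  refine Finset.sum_congr rfl fun k _ => ?_
  simp [Matrix.mul_apply, Matrix.single_apply, ite_and]

lemma choi_mem_tensorFull {ι : Type*} [Fintype ι] {Y : ι → Matrix n n ℂ}
    {S : Submodule ℂ (Matrix n n ℂ)} :
    choi Y ∈ tensorFull S ↔ ∀ B, ∑ k, Y k * B * (Y k)ᴴ ∈ S := by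
  rw [mem_tensorFull]
  simp only [tensorSlice_choi]
  refine ⟨fun h B => ?_, fun h b b' => h _⟩
  have : ∑ k, Y k * B * (Y k)ᴴ = ∑ b, ∑ b', B b b' • ∑ k, Y k * single b b' 1 * (Y k)ᴴ := by
    have hB : B = ∑ b, ∑ b', B b b' • single b b' (1 : ℂ) := by
      conv_lhs => rw [matrix_eq_sum_single B]
      simp [smul_single]
    conv_lhs => rw [hB]
    simp only [Matrix.mul_sum, Matrix.sum_mul, Finset.smul_sum, Matrix.mul_smul, Matrix.smul_mul]
    rw [Finset.sum_comm]
    exact Finset.sum_congr rfl fun b _ => Finset.sum_comm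
  rw [this]
  exact S.sum_mem fun b _ => S.sum_mem fun b' _ => S.smul_mem _ (h b b')

lemma partialTraceA_choi {ι : Type*} [Fintype ι] (Y : ι → Matrix n n ℂ) :
    partialTraceA (choi Y) = (∑ k, (Y k)ᴴ * Y k)ᵀ := by
  ext b b'
  simp only [partialTraceA, of_apply, choi_apply, transpose_apply, Matrix.sum_apply,
    Matrix.mul_apply, conjTranspose_apply]
  rw [Finset.sum_comm]
  exact Finset.sum_congr rfl fun k _ => Finset.sum_congr rfl fun a _ => mul_comm _ _

lemma dotProduct_ketBra {m : Type*} [Fintype m] (v x : m → ℂ) :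
    star x ⬝ᵥ (ketBra v *ᵥ x) = ((‖star x ⬝ᵥ v‖ ^ 2 : ℝ) : ℂ) := by
  have h : star v ⬝ᵥ x = star (star x ⬝ᵥ v) := star_dotProduct v x
  rw [ketBra, vecMulVec_mulVec, h]
  simp only [dotProduct_smul, MulOpposite.smul_eq_mul_unop, MulOpposite.unop_op]
  rw [Complex.star_def, Complex.mul_conj, Complex.normSq_eq_norm_sq]

lemma trace_mul_eq_dotProduct (N M : Matrix n n ℂ) :
    (N * M).trace = star (fun p : n × n => star (N p.2 p.1)) ⬝ᵥ (fun p : n × n => M p.1 p.2) := by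
  simp only [Matrix.trace, Matrix.diag, Matrix.mul_apply, dotProduct, Pi.star_apply, star_star,
    Fintype.sum_prod_type]
  exact Finset.sum_comm

/-- Every test vector is the vectorization of some `Nᴴ`, and its overlap with a vectorized matrix is
a trace against `N`. -/
lemma posSemidef_choi_sub_ketBra_iff {ι : Type*} [Fintype ι] {Y : ι → Matrix n n ℂ}
    {M : Matrix n n ℂ} : (choi Y - ketBra (vectorize M)).PosSemidef ↔
      ∀ N : Matrix n n ℂ, ‖(N * M).trace‖ ^ 2 ≤ ∑ k, ‖(N * Y k).trace‖ ^ 2 := by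
  have hherm : ∀ v : n × n → ℂ, (ketBra v).IsHermitian := fun v =>
    (posSemidef_vecMulVec_self_star v).1
  have hvec : vectorize M = fun p => M p.1 p.2 := funext (vectorize_apply M)
  have key : ∀ x : n × n → ℂ, star x ⬝ᵥ ((choi Y - ketBra (vectorize M)) *ᵥ x) =
      ((∑ k, ‖star x ⬝ᵥ (fun p => Y k p.1 p.2)‖ ^ 2 -
        ‖star x ⬝ᵥ (fun p => M p.1 p.2)‖ ^ 2 : ℝ) : ℂ) := by
    intro x
    rw [sub_mulVec, dotProduct_sub, dotProduct_ketBra, choi, sum_mulVec, dotProduct_sum, hvec]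
    simp only [dotProduct_ketBra]
    push_cast; rfl
  rw [posSemidef_iff_dotProduct_mulVec]
  constructor
  · rintro ⟨-, h⟩ N
    have := h fun p => star (N p.2 p.1)
    rw [key] at this
    simpa only [Complex.zero_le_real, sub_nonneg, ← trace_mul_eq_dotProduct] using this
  · intro h
    refine ⟨IsHermitian.sub (isSelfAdjoint_sum _ fun k _ => hherm _) (hherm _), fun x => ?_⟩
    have := h (of fun b a => star (x (a, b)))
    simp only [trace_mul_eq_dotProduct, of_apply, star_star, Prod.mk.eta] at this
    rw [key, Complex.zero_le_real, sub_nonneg]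
    exact this

/-- Feasibility of `lam` for `θ(S, M M†)`, expressed with the Kraus operators `Y k` of a completely
positive map. -/
structure KrausFeasible {ι : Type*} [Fintype ι] (S : Submodule ℂ (Matrix n n ℂ))
    (M : Matrix n n ℂ) (lam : ℝ) (Y : ι → Matrix n n ℂ) : Prop where
  mem : ∀ B, ∑ k, Y k * B * (Y k)ᴴ ∈ S
  bound : ((lam : ℂ) • (1 : Matrix n n ℂ) - ∑ k, (Y k)ᴴ * Y k).PosSemidef
  dominates : ∀ N : Matrix n n ℂ, ‖(N * M).trace‖ ^ 2 ≤ ∑ k, ‖(N * Y k).trace‖ ^ 2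

/-- The values of the objective over which `θ(S, W)` is the infimum. -/
def thetaSet (S : Submodule ℂ (Matrix n n ℂ)) (W : Matrix n n ℂ) : Set ℝ :=
  {lam : ℝ | ∃ Y ∈ tensorFull S,
    ((lam : ℂ) • (1 : Matrix n n ℂ) - partialTraceA Y).PosSemidef ∧
    (Y - ketBra (vectorize (CFC.sqrt W))).PosSemidef}

lemma smul_one_sub_partialTraceA_choi {ι : Type*} [Fintype ι] (Y : ι → Matrix n n ℂ) (lam : ℝ) :
    (lam : ℂ) • (1 : Matrix n n ℂ) - partialTraceA (choi Y) =
      ((lam : ℂ) • (1 : Matrix n n ℂ) - ∑ k, (Y k)ᴴ * Y k)ᵀ := by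
  rw [partialTraceA_choi, transpose_sub, transpose_smul, transpose_one]

lemma KrausFeasible.mem_thetaSet {ι : Type*} [Fintype ι] {S : Submodule ℂ (Matrix n n ℂ)}
    {W : Matrix n n ℂ} {lam : ℝ} {Y : ι → Matrix n n ℂ}
    (h : KrausFeasible S (CFC.sqrt W) lam Y) : lam ∈ thetaSet S W :=
  ⟨choi Y, choi_mem_tensorFull.mpr h.mem,
    by rw [smul_one_sub_partialTraceA_choi]; exact h.bound.transpose,
    posSemidef_choi_sub_ketBra_iff.mpr h.dominates⟩

lemma exists_krausFeasible {S : Submodule ℂ (Matrix n n ℂ)}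
    {W : Matrix n n ℂ} {lam : ℝ} (h : lam ∈ thetaSet S W) :
    ∃ (m : ℕ) (Y : Fin m → Matrix n n ℂ), KrausFeasible S (CFC.sqrt W) lam Y := by
  obtain ⟨Y, hYS, hb, hd⟩ := h
  -- Positivity is automatic, since `Y` dominates a rank-one positive operator; this is what
  -- provides Kraus operators.
  have hY : Y.PosSemidef := by
    have := hd.add (posSemidef_vecMulVec_self_star (vectorize (CFC.sqrt W)))
    rwa [ketBra, sub_add_cancel] at this
  obtain ⟨m, K, rfl⟩ := exists_choi_eq hY
  refine ⟨m, K, choi_mem_tensorFull.mp hYS, ?_, posSemidef_choi_sub_ketBra_iff.mp hd⟩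
  rwa [smul_one_sub_partialTraceA_choi, posSemidef_transpose_iff] at hb

lemma nonneg_of_mem_thetaSet [Nonempty n] {S : Submodule ℂ (Matrix n n ℂ)}
    {W : Matrix n n ℂ} {lam : ℝ} (h : lam ∈ thetaSet S W) : 0 ≤ lam := by
  obtain ⟨m, Y, hY⟩ := exists_krausFeasible h
  have h1 : ((lam : ℂ) • (1 : Matrix n n ℂ)).PosSemidef := by
    have := hY.bound.add (posSemidef_sum Finset.univ fun k _ =>
      posSemidef_conjTranspose_mul_self (Y k))
    rwa [sub_add_cancel] at this
  have := h1.diag_nonneg (i := Classical.arbitrary n)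
  simpa using this

lemma bddBelow_thetaSet [Nonempty n] (S : Submodule ℂ (Matrix n n ℂ)) (W : Matrix n n ℂ) :
    BddBelow (thetaSet S W) := ⟨0, fun _ => nonneg_of_mem_thetaSet⟩

lemma theta_nonneg [Nonempty n] (S : Submodule ℂ (Matrix n n ℂ)) (W : Matrix n n ℂ) :
    0 ≤ theta S W := Real.sInf_nonneg fun _ => nonneg_of_mem_thetaSet

end Kraus
end WeightedTheta

namespace WeightedTheta
open Matrix

/-! ### Matrix units on tensor factors. -/

section KroneckerUnits

variable {a y : Type*} [Fintype a] [DecidableEq a] [Fintype y] [DecidableEq y]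

lemma sum_kronecker {κ : Type*} (s : Finset κ) (f : κ → Matrix a a ℂ) (L : Matrix y y ℂ) :
    (∑ k ∈ s, f k) ⊗ₖ L = ∑ k ∈ s, f k ⊗ₖ L := by
  ext ⟨i, j⟩ ⟨i', j'⟩
  simp [Matrix.sum_apply, Finset.sum_mul]

lemma kronecker_sum {κ : Type*} (s : Finset κ) (M : Matrix a a ℂ) (f : κ → Matrix y y ℂ) :
    M ⊗ₖ (∑ k ∈ s, f k) = ∑ k ∈ s, M ⊗ₖ f k := by
  ext ⟨i, j⟩ ⟨i', j'⟩
  simp [Matrix.sum_apply, Finset.mul_sum]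

/-- Conjugating by all matrix units of a factor replaces that factor by its trace times the
identity. -/
lemma sum_single_kronecker_one_conj (N : Matrix (a × y) (a × y) ℂ) :
    ∑ p : a × a, (single p.1 p.2 (1 : ℂ) ⊗ₖ (1 : Matrix y y ℂ)) * N *
      (single p.1 p.2 (1 : ℂ) ⊗ₖ (1 : Matrix y y ℂ))ᴴ =
    (1 : Matrix a a ℂ) ⊗ₖ (of fun i j => ∑ b, N (b, i) (b, j)) := by
  ext ⟨i, j⟩ ⟨i', j'⟩
  simp [Matrix.sum_apply, Matrix.mul_apply, Fintype.sum_prod_type, Matrix.single_apply,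
    Matrix.one_apply, ite_and, apply_ite (starRingEnd ℂ)]
  simp only [eq_comm]

lemma sum_one_kronecker_single_conj (N : Matrix (a × y) (a × y) ℂ) :
    ∑ p : y × y, ((1 : Matrix a a ℂ) ⊗ₖ single p.1 p.2 (1 : ℂ)) * N *
      ((1 : Matrix a a ℂ) ⊗ₖ single p.1 p.2 (1 : ℂ))ᴴ =
    (of fun i j => ∑ b, N (i, b) (j, b)) ⊗ₖ (1 : Matrix y y ℂ) := by
  ext ⟨i, j⟩ ⟨i', j'⟩
  simp [Matrix.sum_apply, Matrix.mul_apply, Fintype.sum_prod_type, Matrix.single_apply,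
    Matrix.one_apply, ite_and, apply_ite (starRingEnd ℂ)]
  simp only [eq_comm]

lemma sum_conjTranspose_single_mul_single :
    ∑ p : a × a, (single p.1 p.2 (1 : ℂ))ᴴ * single p.1 p.2 (1 : ℂ) =
      (Fintype.card a : ℂ) • (1 : Matrix a a ℂ) := by
  ext i j
  simp [Matrix.sum_apply, Fintype.sum_prod_type, Matrix.single_apply, Matrix.one_apply, ite_and]
  split_ifs <;> simp

lemma trace_conjTranspose_single_mul_single (p q : a × a) :
    ((single p.1 p.2 (1 : ℂ))ᴴ * single q.1 q.2 (1 : ℂ)).trace = if p = q then 1 else 0 := by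
  rcases p with ⟨b, c⟩
  rcases q with ⟨b', c'⟩
  simp [Matrix.trace, Matrix.mul_apply, Matrix.single_apply, ite_and, Prod.ext_iff]
  split_ifs <;> rfl

end KroneckerUnits

/-! ### Matrix units of S₀ and S₀', and the operator D. -/

namespace BlockDecomposition

variable {n : Type*} [Fintype n] [DecidableEq n] {S₀ : StarSubalgebra ℂ (Matrix n n ℂ)}
  (d : BlockDecomposition S₀)

/-- The isometric embedding of the `i`-th summand `Aᵢ ⊗ Yᵢ`. -/
def V (i : Fin d.r) : Matrix n (Fin (d.dimA i) × Fin (d.dimY i)) ℂ :=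
  d.U.submatrix id fun p => ⟨i, p⟩

lemma V_conjTranspose_mul_V (i : Fin d.r) : (d.V i)ᴴ * d.V i = 1 := by
  ext p q
  refine (congrFun (congrFun d.conjTranspose_mul_self ⟨i, p⟩) ⟨i, q⟩).trans ?_
  simp [Matrix.one_apply]

lemma V_conjTranspose_mul_V_of_ne {i j : Fin d.r} (h : i ≠ j) : (d.V i)ᴴ * d.V j = 0 := by
  ext p q
  refine (congrFun (congrFun d.conjTranspose_mul_self ⟨i, p⟩) ⟨j, q⟩).trans ?_
  simp [h]

/-- The operator on `A` that acts as `N` on the `i`-th summand. -/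
def conj (i : Fin d.r) (N : Matrix (Fin (d.dimA i) × Fin (d.dimY i))
    (Fin (d.dimA i) × Fin (d.dimY i)) ℂ) : Matrix n n ℂ :=
  d.V i * N * (d.V i)ᴴ

lemma conj_mul_conj (i : Fin d.r) (N N') : d.conj i N * d.conj i N' = d.conj i (N * N') := by
  simp only [conj, Matrix.mul_assoc]
  rw [← Matrix.mul_assoc _ (d.V i), V_conjTranspose_mul_V, Matrix.one_mul]

lemma conj_mul_conj_of_ne {i j : Fin d.r} (h : i ≠ j) (N N') :
    d.conj i N * d.conj j N' = 0 := by
  simp only [conj, Matrix.mul_assoc]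
  rw [← Matrix.mul_assoc _ (d.V j), V_conjTranspose_mul_V_of_ne d h]
  simp

lemma conjTranspose_conj (i : Fin d.r) (N) : (d.conj i N)ᴴ = d.conj i Nᴴ := by
  simp [conj, Matrix.mul_assoc]

lemma trace_conj (i : Fin d.r) (N) : (d.conj i N).trace = N.trace := by
  rw [conj, Matrix.trace_mul_comm, ← Matrix.mul_assoc, V_conjTranspose_mul_V, Matrix.one_mul]

lemma conj_smul (i : Fin d.r) (c : ℂ) (N) : d.conj i (c • N) = c • d.conj i N := by
  simp [conj]

lemma conj_sum {κ : Type*} (s : Finset κ) (i : Fin d.r) (N : κ → _) :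
    d.conj i (∑ k ∈ s, N k) = ∑ k ∈ s, d.conj i (N k) := by
  simp [conj, Matrix.mul_sum, Matrix.sum_mul]

lemma mul_blockDiagonal' (F : ∀ i, Matrix (Fin (d.dimA i) × Fin (d.dimY i))
    (Fin (d.dimA i) × Fin (d.dimY i)) ℂ) :
    d.U * Matrix.blockDiagonal' F * d.Uᴴ = ∑ i, d.conj i (F i) :=
  mul_blockDiagonal'_mul d.U F

lemma sum_conj_one : ∑ i, d.conj i 1 = 1 := by
  rw [← d.mul_blockDiagonal' fun i => 1]
  have : Matrix.blockDiagonal' (fun i => (1 : Matrix (Fin (d.dimA i) × Fin (d.dimY i))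
    (Fin (d.dimA i) × Fin (d.dimY i)) ℂ)) = 1 := Matrix.blockDiagonal'_one
  rw [this, Matrix.mul_one, d.mul_conjTranspose_self]

lemma proj_eq (i : Fin d.r) : d.proj i = d.conj i 1 := by
  have : (Matrix.diagonal fun k => if k.1 = i then 1 else 0 :
      Matrix (Σ i : Fin d.r, Fin (d.dimA i) × Fin (d.dimY i)) _ ℂ) =
      Matrix.blockDiagonal' fun j => if j = i then 1 else 0 := by
    ext ⟨j, p⟩ ⟨k, q⟩
    by_cases h : j = k
    · subst h
      rw [blockDiagonal'_apply_eq, Matrix.diagonal_apply]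
      split_ifs <;> simp_all [Matrix.one_apply]
    · rw [blockDiagonal'_apply_ne _ _ _ h, Matrix.diagonal_apply_ne _ (by simp [h])]
  rw [proj, this, mul_blockDiagonal', Finset.sum_eq_single i]
  · simp
  · intro j _ hj
    simp [hj, conj]
  · simp

lemma sum_conj_mul_conj (F : ∀ i, Matrix (Fin (d.dimA i) × Fin (d.dimY i))
    (Fin (d.dimA i) × Fin (d.dimY i)) ℂ) (i : Fin d.r) (N) :
    (∑ j, d.conj j (F j)) * d.conj i N = d.conj i (F i * N) := by
  rw [Finset.sum_mul, Finset.sum_eq_single i, conj_mul_conj]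
  · exact fun j _ hj => d.conj_mul_conj_of_ne hj _ _
  · simp

lemma conj_mul_sum_conj (F : ∀ i, Matrix (Fin (d.dimA i) × Fin (d.dimY i))
    (Fin (d.dimA i) × Fin (d.dimY i)) ℂ) (i : Fin d.r) (N) :
    d.conj i N * (∑ j, d.conj j (F j)) = d.conj i (N * F i) := by
  rw [Finset.mul_sum, Finset.sum_eq_single i, conj_mul_conj]
  · exact fun j _ hj => d.conj_mul_conj_of_ne hj.symm _ _
  · simp

lemma mem_iff_sum {X : Matrix n n ℂ} : X ∈ S₀ ↔
    ∃ M : (i : Fin d.r) → Matrix (Fin (d.dimA i)) (Fin (d.dimA i)) ℂ,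
      X = ∑ i, d.conj i (M i ⊗ₖ 1) := by
  rw [d.mem_iff]
  simp only [mul_blockDiagonal']

lemma conj_kronecker_one_mem (i : Fin d.r) (M : Matrix (Fin (d.dimA i)) (Fin (d.dimA i)) ℂ) :
    d.conj i (M ⊗ₖ 1) ∈ S₀ := by
  classical
  refine d.mem_iff_sum.mpr ⟨fun j => if h : i = j then h ▸ M else 0, ?_⟩
  rw [Finset.sum_eq_single i]
  · simp
  · intro j _ hj
    simp [hj.symm, conj]
  · simp

lemma conj_one_kronecker_mem (i : Fin d.r) (L : Matrix (Fin (d.dimY i)) (Fin (d.dimY i)) ℂ) :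
    d.conj i (1 ⊗ₖ L) ∈ commutant S₀ := by
  intro K hK
  obtain ⟨M, rfl⟩ := d.mem_iff_sum.mp hK
  rw [sum_conj_mul_conj, conj_mul_sum_conj, ← mul_kronecker_mul, ← mul_kronecker_mul]
  simp

/-- The operator with eigenvalue `c i` on the `i`-th summand. -/
def scalar (c : Fin d.r → ℝ) : Matrix n n ℂ := ∑ i, d.conj i ((c i : ℂ) • 1)

lemma scalar_mul_scalar (c c' : Fin d.r → ℝ) :
    d.scalar c * d.scalar c' = d.scalar fun i => c i * c' i := by
  simp only [scalar]
  rw [Finset.mul_sum]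
  refine Finset.sum_congr rfl fun i _ => ?_
  rw [sum_conj_mul_conj]
  simp only [Matrix.smul_mul, Matrix.one_mul, smul_smul, Complex.ofReal_mul]

lemma scalar_mul_conj (c : Fin d.r → ℝ) (i : Fin d.r) (N) :
    d.scalar c * d.conj i N = (c i : ℂ) • d.conj i N := by
  rw [scalar, sum_conj_mul_conj, Matrix.smul_mul, Matrix.one_mul, conj_smul]

lemma scalar_one : (d.scalar fun _ => 1) = 1 := by
  rw [← d.sum_conj_one]
  simp [scalar]

lemma conjTranspose_scalar (c : Fin d.r → ℝ) : (d.scalar c)ᴴ = d.scalar c := by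
  simp [scalar, conjTranspose_sum, conjTranspose_conj]

lemma scalar_mem (c : Fin d.r → ℝ) : d.scalar c ∈ S₀ :=
  d.mem_iff_sum.mpr ⟨fun i => (c i : ℂ) • 1, by simp [scalar, smul_kronecker]⟩

lemma scalar_mul_comm (c : Fin d.r → ℝ) {X : Matrix n n ℂ} (hX : X ∈ S₀) :
    d.scalar c * X = X * d.scalar c := by
  obtain ⟨M, rfl⟩ := d.mem_iff_sum.mp hX
  rw [scalar, Finset.sum_mul, Finset.mul_sum]
  refine Finset.sum_congr rfl fun i _ => ?_
  rw [sum_conj_mul_conj, conj_mul_sum_conj]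
  simp

lemma scalar_mem_commutant (c : Fin d.r → ℝ) : d.scalar c ∈ commutant S₀ :=
  fun _ hX => (d.scalar_mul_comm c hX).symm

lemma scalar_posSemidef {c : Fin d.r → ℝ} (hc : ∀ i, 0 ≤ c i) : (d.scalar c).PosSemidef := by
  refine posSemidef_sum _ fun i _ => ?_
  exact (PosSemidef.smul PosSemidef.one
    (Complex.zero_le_real.mpr (hc i))).mul_mul_conjTranspose_same (d.V i)

/-- The ratios `dim Yᵢ / dim Aᵢ`. -/
noncomputable def ratio (i : Fin d.r) : ℝ := (d.dimA i : ℝ)⁻¹ * d.dimY i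

lemma ratio_pos (i : Fin d.r) : 0 < d.ratio i :=
  mul_pos (inv_pos.mpr (Nat.cast_pos.mpr (d.dimA_pos i))) (Nat.cast_pos.mpr (d.dimY_pos i))

lemma scaling_eq : d.scaling = d.scalar d.ratio := by
  simp [scaling, scalar, proj_eq, conj_smul, ratio]

lemma sqrt_scaling : CFC.sqrt d.scaling = d.scalar fun i => √(d.ratio i) := by
  refine CFC.sqrt_unique ?_ (d.scalar_posSemidef fun i => Real.sqrt_nonneg _).nonneg
  rw [scalar_mul_scalar, scaling_eq]
  congr 1; ext i
  exact Real.mul_self_sqrt (d.ratio_pos i).le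

/-- The weight `(dim Aᵢ)⁻¹`. -/
noncomputable def weight (i : Fin d.r) : ℝ := (d.dimA i : ℝ)⁻¹

lemma weight_pos (i : Fin d.r) : 0 < d.weight i := inv_pos.mpr (Nat.cast_pos.mpr (d.dimA_pos i))

/-- The matrix units of `S₀`. -/
def unitA (k : Σ i, Fin (d.dimA i) × Fin (d.dimA i)) : Matrix n n ℂ :=
  d.conj k.1 (single k.2.1 k.2.2 1 ⊗ₖ 1)

/-- The matrix units of the commutant of `S₀`. -/
def unitY (k : Σ i, Fin (d.dimY i) × Fin (d.dimY i)) : Matrix n n ℂ :=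
  d.conj k.1 (1 ⊗ₖ single k.2.1 k.2.2 1)

lemma unitA_mem (k) : d.unitA k ∈ S₀ := d.conj_kronecker_one_mem _ _

lemma unitY_mem (k) : d.unitY k ∈ commutant S₀ := d.conj_one_kronecker_mem _ _

lemma conj_mul_mul_conj (i : Fin d.r) (N N') (X : Matrix n n ℂ) :
    d.conj i N * X * d.conj i N' = d.conj i (N * ((d.V i)ᴴ * X * d.V i) * N') := by
  simp only [conj, Matrix.mul_assoc]

/-- The projection of operators onto the commutant of `S₀`. -/
noncomputable def expCommutant (X : Matrix n n ℂ) : Matrix n n ℂ :=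
  ∑ k, (d.weight k.1 : ℂ) • (d.unitA k * X * (d.unitA k)ᴴ)

lemma commutant_sum {κ : Type*} {s : Finset κ} {f : κ → Matrix n n ℂ}
    (h : ∀ k ∈ s, f k ∈ commutant S₀) : ∑ k ∈ s, f k ∈ commutant S₀ := fun K hK => by
  rw [Finset.mul_sum, Finset.sum_mul]
  exact Finset.sum_congr rfl fun k hk => h k hk K hK

lemma expCommutant_mem (X : Matrix n n ℂ) : d.expCommutant X ∈ commutant S₀ := by
  rw [expCommutant, Fintype.sum_sigma]
  refine commutant_sum fun i _ => ?_
  change ∑ p : Fin (d.dimA i) × Fin (d.dimA i), (d.weight i : ℂ) •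
    (d.conj i (single p.1 p.2 1 ⊗ₖ 1) * X * (d.conj i (single p.1 p.2 1 ⊗ₖ 1))ᴴ) ∈ _
  simp only [conjTranspose_conj, conj_mul_mul_conj, ← Finset.smul_sum, ← conj_sum,
    sum_single_kronecker_one_conj]
  rw [← conj_smul, ← kronecker_smul]
  exact d.conj_one_kronecker_mem _ _

lemma sum_unitY_conj_mem (X : Matrix n n ℂ) :
    ∑ k, (d.weight k.1 : ℂ) • (d.unitY k * X * (d.unitY k)ᴴ) ∈ S₀ := by
  rw [Fintype.sum_sigma]
  refine sum_mem fun i _ => ?_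
  change ∑ p : Fin (d.dimY i) × Fin (d.dimY i), (d.weight i : ℂ) •
    (d.conj i (1 ⊗ₖ single p.1 p.2 1) * X * (d.conj i (1 ⊗ₖ single p.1 p.2 1))ᴴ) ∈ _
  simp only [conjTranspose_conj, conj_mul_mul_conj, ← Finset.smul_sum, ← conj_sum,
    sum_one_kronecker_single_conj]
  rw [← conj_smul, ← smul_kronecker]
  exact d.conj_kronecker_one_mem _ _

lemma sum_unitA_conjTranspose_mul :
    ∑ k, (d.weight k.1 : ℂ) • ((d.unitA k)ᴴ * d.unitA k) = 1 := by
  rw [Fintype.sum_sigma, ← d.sum_conj_one]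
  refine Finset.sum_congr rfl fun i _ => ?_
  change ∑ p : Fin (d.dimA i) × Fin (d.dimA i), (d.weight i : ℂ) •
    ((d.conj i (single p.1 p.2 1 ⊗ₖ 1))ᴴ * d.conj i (single p.1 p.2 1 ⊗ₖ 1)) = _
  simp only [conjTranspose_conj, conj_mul_conj, ← Finset.smul_sum, ← conj_sum,
    conjTranspose_kronecker, ← mul_kronecker_mul, conjTranspose_one, Matrix.mul_one,
    ← sum_kronecker, sum_conjTranspose_single_mul_single, smul_kronecker, one_kronecker_one,
    conj_smul, smul_smul, Fintype.card_fin]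
  have := (d.dimA_pos i).ne'
  simp [weight, this]

/-- This is where D comes from: on the i-th summand the units contribute dim Yᵢ, against the weight
1/dim Aᵢ that normalizes them in Hilbert–Schmidt norm. -/
lemma sum_unitY_conjTranspose_mul :
    ∑ k, (d.weight k.1 : ℂ) • ((d.unitY k)ᴴ * d.unitY k) = d.scaling := by
  rw [Fintype.sum_sigma, scaling_eq, scalar]
  refine Finset.sum_congr rfl fun i _ => ?_
  change ∑ p : Fin (d.dimY i) × Fin (d.dimY i), (d.weight i : ℂ) •
    ((d.conj i (1 ⊗ₖ single p.1 p.2 1))ᴴ * d.conj i (1 ⊗ₖ single p.1 p.2 1)) = _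
  simp only [conjTranspose_conj, conj_mul_conj, ← Finset.smul_sum, ← conj_sum,
    conjTranspose_kronecker, ← mul_kronecker_mul, conjTranspose_one, Matrix.mul_one,
    ← kronecker_sum, sum_conjTranspose_single_mul_single, kronecker_smul, one_kronecker_one,
    conj_smul, smul_smul, Fintype.card_fin]
  simp [weight, ratio]

lemma trace_unitY_conjTranspose_mul (k l) :
    ((d.unitY k)ᴴ * d.unitY l).trace = if k = l then ((d.weight k.1 : ℂ))⁻¹ else 0 := by
  obtain ⟨i, p⟩ := k
  obtain ⟨j, q⟩ := l
  by_cases h : i = j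
  · subst h
    simp only [unitY, conjTranspose_conj, conj_mul_conj, trace_conj, conjTranspose_kronecker,
      ← mul_kronecker_mul, trace_kronecker, conjTranspose_one, Matrix.mul_one,
      trace_conjTranspose_single_mul_single]
    simp [weight]
  · rw [unitY, unitY, conjTranspose_conj, conj_mul_conj_of_ne _ h]
    simp [h]

/-- The units of S₀ have squared norm dim Yᵢ; inserting D⁻¹ turns this into dim Aᵢ, which the weight
cancels when dual solutions are projected onto S₀'. -/
lemma trace_unitA_conjTranspose_mul_scalar_mul (k l) :
    ((d.unitA k)ᴴ * (d.scalar fun i => (d.ratio i)⁻¹) * d.unitA l).trace =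
      if k = l then ((d.weight k.1 : ℂ))⁻¹ else 0 := by
  rw [Matrix.mul_assoc, unitA, unitA, scalar_mul_conj, Matrix.mul_smul, Matrix.trace_smul]
  obtain ⟨i, p⟩ := k
  obtain ⟨j, q⟩ := l
  by_cases h : i = j
  · subst h
    simp only [conjTranspose_conj, conj_mul_conj, trace_conj, conjTranspose_kronecker,
      ← mul_kronecker_mul, trace_kronecker, conjTranspose_one, Matrix.mul_one,
      trace_conjTranspose_single_mul_single]
    have : (d.dimY i : ℂ) ≠ 0 := Nat.cast_ne_zero.mpr (d.dimY_pos i).ne'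
    by_cases hpq : p = q
    · simp only [hpq, weight, ratio, if_true, Fintype.card_fin, trace_one]
      push_cast
      field_simp
      rw [smul_eq_mul, div_mul_cancel₀ _ this]
    · simp [hpq]
  · rw [conjTranspose_conj, conj_mul_conj_of_ne _ h]
    simp [h]

end BlockDecomposition
end WeightedTheta

namespace WeightedTheta
open Matrix

/-! ### The product inequality for feasible values. -/

section Duality

variable {n : Type*} [Fintype n] [DecidableEq n] {S₀ : StarSubalgebra ℂ (Matrix n n ℂ)}
  {S : Submodule ℂ (Matrix n n ℂ)}

lemma norm_trace_conjTranspose (A : Matrix n n ℂ) : ‖Aᴴ.trace‖ = ‖A.trace‖ := by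
  rw [trace_conjTranspose, norm_star]

lemma trace_mul_conjTranspose_eq_zero {X P : Matrix n n ℂ} (hX : X ∈ S)
    (hP : P ∈ hsOrthogonal S) : (X * Pᴴ).trace = 0 := by
  have := hP X hX
  rw [← star_eq_zero, ← trace_conjTranspose, conjTranspose_mul, conjTranspose_conjTranspose,
    Matrix.trace_mul_comm] at this
  exact this

lemma trace_mul_le {P Q : Matrix n n ℂ} {lam : ℝ} (hP : P.PosSemidef)
    (hQ : ((lam : ℂ) • (1 : Matrix n n ℂ) - Q).PosSemidef) :
    (P * Q).trace ≤ lam * P.trace := by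
  have := trace_mul_nonneg hP hQ
  rw [Matrix.mul_sub, Matrix.mul_smul, Matrix.mul_one, Matrix.trace_sub, Matrix.trace_smul,
    smul_eq_mul, sub_nonneg] at this
  exact this

lemma norm_trace_sq_eq_sum (A : Matrix n n ℂ) :
    ((‖A.trace‖ ^ 2 : ℝ) : ℂ) = ∑ p : n × n, (A * single p.1 p.2 1 * Aᴴ * single p.2 p.1 1).trace := by
  have h : ∀ p : n × n, (A * single p.1 p.2 1 * Aᴴ * single p.2 p.1 1).trace =
      A p.1 p.1 * star (A p.2 p.2) := fun p => by
    rw [Matrix.trace_mul_single]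
    simp [Matrix.mul_apply, Matrix.single_apply, ite_and]
  rw [← Complex.normSq_eq_norm_sq, ← Complex.mul_conj, Finset.sum_congr rfl fun p _ => h p,
    Fintype.sum_prod_type]
  simp only [Matrix.trace, Matrix.diag, map_sum, Finset.sum_mul_sum, Complex.star_def]

/-- Writing the sum through values of the two completely positive maps lets membership in S and S^⊥
+ S₀ be used. -/
lemma sum_norm_trace_sq_eq {ι κ : Type*} [Fintype ι] [Fintype κ] (Y : ι → Matrix n n ℂ)
    (Z : κ → Matrix n n ℂ) (K C : Matrix n n ℂ) :
    ((∑ l, ∑ k, ‖((Z l)ᴴ * K * Y k * C).trace‖ ^ 2 : ℝ) : ℂ) =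
      ∑ p : n × n, (K * (∑ k, Y k * (C * single p.1 p.2 1 * Cᴴ) * (Y k)ᴴ) * Kᴴ *
        (∑ l, Z l * single p.1 p.2 1 * (Z l)ᴴ)ᴴ).trace := by
  push_cast
  simp only [← Complex.ofReal_pow, norm_trace_sq_eq_sum, conjTranspose_sum, Matrix.mul_sum,
    Matrix.sum_mul, Matrix.trace_sum]
  conv_lhs => enter [2, l]; rw [Finset.sum_comm]
  rw [Finset.sum_comm]
  refine Finset.sum_congr rfl fun p _ => ?_
  refine Finset.sum_congr rfl fun l _ => Finset.sum_congr rfl fun k _ => ?_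
  simp only [conjTranspose_mul, conjTranspose_conjTranspose, conjTranspose_single, star_one,
    Matrix.mul_assoc]
  rw [Matrix.trace_mul_comm]
  simp only [Matrix.mul_assoc]

namespace BlockDecomposition

variable (d : BlockDecomposition S₀)

lemma scaling_posSemidef : d.scaling.PosSemidef := by
  rw [scaling_eq]
  exact d.scalar_posSemidef fun i => (d.ratio_pos i).le

/-- Pairing an element of `S` with one of `S^⊥ + S₀` sees only the `S₀`-components. -/
lemma trace_scalar_mul_mul_eq (hS : IsGraphOver S₀ S) {X X' : Matrix n n ℂ} (hX : X ∈ S)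
    (hX' : X' ∈ graphCompl S₀ S) :
    (CFC.sqrt d.scaling * X * (CFC.sqrt d.scaling)ᴴ * X'ᴴ).trace =
      ∑ k, (d.weight k.1 : ℂ) * (d.unitY k * X * (d.unitY k)ᴴ * X'ᴴ).trace := by
  have hD : CFC.sqrt d.scaling ∈ S₀ := by rw [sqrt_scaling]; exact d.scalar_mem _
  have hDD : (CFC.sqrt d.scaling)ᴴ * CFC.sqrt d.scaling = d.scaling := by
    rw [sqrt_scaling, conjTranspose_scalar, ← sqrt_scaling,
      CFC.sqrt_mul_sqrt_self _ d.scaling_posSemidef.nonneg]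
  obtain ⟨P, hP, Q, hQ, rfl⟩ := Submodule.mem_sup.mp hX'
  have hQ' : Qᴴ ∈ S₀ := conjTranspose_mem_algebra hQ
  have hR : ∑ k, (d.weight k.1 : ℂ) * (d.unitY k * X * (d.unitY k)ᴴ * (P + Q)ᴴ).trace =
      ((∑ k, (d.weight k.1 : ℂ) • (d.unitY k * X * (d.unitY k)ᴴ)) * (P + Q)ᴴ).trace := by
    simp [Matrix.sum_mul, Matrix.trace_sum]
  have hcomm : ∀ k, (d.unitY k)ᴴ * Qᴴ = Qᴴ * (d.unitY k)ᴴ := fun k => by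
    rw [← conjTranspose_mul, ← conjTranspose_mul, d.unitY_mem k Q hQ]
  rw [hR, conjTranspose_add, Matrix.mul_add, Matrix.mul_add, Matrix.trace_add, Matrix.trace_add,
    trace_mul_conjTranspose_eq_zero
      (hS.mul_mul_mem hD hX (conjTranspose_mem_algebra hD)) hP,
    trace_mul_conjTranspose_eq_zero (hS.vertexSpace_le (d.sum_unitY_conj_mem X)) hP, zero_add,
    zero_add]
  -- Only the S₀-component `Q` is left. It commutes with √D, which is central in S₀, and with the
  -- units of S₀', so both sides reduce to this trace.
  calc _ = (X * Qᴴ * d.scaling).trace := by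
        have h1 : (CFC.sqrt d.scaling)ᴴ * Qᴴ = Qᴴ * (CFC.sqrt d.scaling)ᴴ := by
          rw [sqrt_scaling, conjTranspose_scalar, d.scalar_mul_comm _ hQ']
        rw [Matrix.mul_assoc _ _ Qᴴ, h1, Matrix.mul_assoc, Matrix.trace_mul_comm]
        conv_rhs => rw [← hDD]
        simp only [Matrix.mul_assoc]
    _ = _ := by
        rw [← d.sum_unitY_conjTranspose_mul, Matrix.mul_sum, Matrix.sum_mul, Matrix.trace_sum,
          Matrix.trace_sum]
        refine Finset.sum_congr rfl fun k _ => ?_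
        rw [Matrix.mul_smul, Matrix.smul_mul, Matrix.trace_smul, Matrix.trace_smul,
          Matrix.mul_assoc _ _ Qᴴ, hcomm, ← Matrix.mul_assoc,
          Matrix.trace_mul_comm (X * Qᴴ * (d.unitY k)ᴴ)]
        simp only [Matrix.mul_assoc]

/-- Bessel's inequality for the orthonormal family √wₖ Fₖ. -/
lemma sum_weight_norm_trace_sq_le (N : Matrix n n ℂ) :
    ((∑ k, d.weight k.1 * ‖(d.unitY k * N).trace‖ ^ 2 : ℝ) : ℂ) ≤ (N * Nᴴ).trace := by
  have hv : Orthonormal ℂ fun k => (√(d.weight k.1) : ℂ) • vecEquiv n (d.unitY k) := by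
    rw [orthonormal_iff_ite]
    intro k l
    rw [inner_smul_left, inner_smul_right, inner_vecEquiv, d.trace_unitY_conjTranspose_mul]
    split_ifs with h
    · subst h
      rw [Complex.conj_ofReal, ← mul_assoc, ← Complex.ofReal_mul,
        Real.mul_self_sqrt (d.weight_pos _).le, mul_inv_cancel₀]
      exact_mod_cast (d.weight_pos _).ne'
    · simp
  have h := hv.sum_inner_products_le (x := vecEquiv n Nᴴ) (s := Finset.univ)
  have h2 := norm_vecEquiv_sq Nᴴ
  rw [conjTranspose_conjTranspose] at h2
  rw [← h2, Complex.real_le_real]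
  refine le_trans (le_of_eq (Finset.sum_congr rfl fun k _ => ?_)) h
  rw [inner_smul_left, inner_vecEquiv, norm_mul, mul_pow, Complex.conj_ofReal, Complex.norm_real,
    Real.norm_eq_abs, sq_abs, Real.sq_sqrt (d.weight_pos _).le, ← conjTranspose_mul,
    norm_trace_conjTranspose, Matrix.trace_mul_comm]

/-- Replace √D by the weighted units of S₀', apply Bessel to each `Y k * C * (Z l)ᴴ`, then use the
bounds on ∑ Yₖ†Yₖ and ∑ Zₗ†Zₗ. -/
lemma sum_norm_trace_sq_le (hS : IsGraphOver S₀ S) {ι κ : Type*} [Fintype ι] [Fintype κ]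
    {M M' : Matrix n n ℂ} {lam mu : ℝ} {Y : ι → Matrix n n ℂ} {Z : κ → Matrix n n ℂ}
    (hY : KrausFeasible S M lam Y) (hZ : KrausFeasible (graphCompl S₀ S) M' mu Z)
    (hlam : 0 ≤ lam) (C : Matrix n n ℂ) :
    ((∑ l, ∑ k, ‖((Z l)ᴴ * CFC.sqrt d.scaling * Y k * C).trace‖ ^ 2 : ℝ) : ℂ) ≤
      lam * mu * (Cᴴ * C).trace := by
  have h1 : ((∑ l, ∑ k, ‖((Z l)ᴴ * CFC.sqrt d.scaling * Y k * C).trace‖ ^ 2 : ℝ) : ℂ) =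
      ∑ j, (d.weight j.1 : ℂ) *
        ((∑ l, ∑ k, ‖((Z l)ᴴ * d.unitY j * Y k * C).trace‖ ^ 2 : ℝ) : ℂ) := by
    simp only [sum_norm_trace_sq_eq]
    refine (Finset.sum_congr rfl fun p _ =>
      d.trace_scalar_mul_mul_eq hS (hY.mem _) (hZ.mem _)).trans ?_
    rw [Finset.sum_comm]
    exact Finset.sum_congr rfl fun j _ => (Finset.mul_sum _ _ _).symm
  have h2 : ((∑ l, ∑ k, ‖((Z l)ᴴ * CFC.sqrt d.scaling * Y k * C).trace‖ ^ 2 : ℝ) : ℂ) =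
      ∑ l, ∑ k, ((∑ j, d.weight j.1 *
        ‖(d.unitY j * (Y k * C * (Z l)ᴴ)).trace‖ ^ 2 : ℝ) : ℂ) := by
    rw [h1]
    push_cast
    simp only [Finset.mul_sum]
    rw [Finset.sum_comm]
    refine Finset.sum_congr rfl fun l _ => ?_
    rw [Finset.sum_comm]
    refine Finset.sum_congr rfl fun k _ => Finset.sum_congr rfl fun j _ => ?_
    rw [Matrix.mul_assoc, Matrix.mul_assoc, Matrix.trace_mul_comm]
    simp only [Matrix.mul_assoc]
  have h3 : ∑ l, ∑ k, (Y k * C * (Z l)ᴴ * (Y k * C * (Z l)ᴴ)ᴴ).trace =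
      ((C * (∑ l, (Z l)ᴴ * Z l) * Cᴴ) * ∑ k, (Y k)ᴴ * Y k).trace := by
    simp only [Matrix.mul_sum, Matrix.sum_mul, Matrix.trace_sum]
    rw [Finset.sum_comm]
    refine Finset.sum_congr rfl fun k _ => Finset.sum_congr rfl fun l _ => ?_
    rw [Matrix.mul_assoc (Y k), Matrix.mul_assoc (Y k), Matrix.trace_mul_comm]
    simp only [conjTranspose_mul, conjTranspose_conjTranspose, Matrix.mul_assoc]
  have hpsd : (∑ l, (Z l)ᴴ * Z l).PosSemidef :=
    posSemidef_sum Finset.univ fun l _ => posSemidef_conjTranspose_mul_self (Z l)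
  rw [h2]
  refine (Finset.sum_le_sum fun l _ => Finset.sum_le_sum fun k _ =>
    d.sum_weight_norm_trace_sq_le _).trans ?_
  rw [h3]
  refine (trace_mul_le (hpsd.mul_mul_conjTranspose_same C) hY.bound).trans ?_
  rw [mul_assoc (lam : ℂ)]
  refine mul_le_mul_of_nonneg_left ?_ (Complex.zero_le_real.mpr hlam)
  rw [Matrix.mul_assoc, Matrix.trace_mul_comm, Matrix.mul_assoc, Matrix.trace_mul_comm]
  exact trace_mul_le (posSemidef_conjTranspose_mul_self C) hZ.bound

lemma trace_eq_conjTranspose_mul_self {V W : Matrix n n ℂ} (hV : V.PosSemidef)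
    (hW : W.PosSemidef) :
    (V * CFC.sqrt d.scaling * W * CFC.sqrt d.scaling).trace =
      ((CFC.sqrt V * CFC.sqrt d.scaling * CFC.sqrt W)ᴴ *
        (CFC.sqrt V * CFC.sqrt d.scaling * CFC.sqrt W)).trace := by
  have hh : ∀ X : Matrix n n ℂ, (CFC.sqrt X)ᴴ = CFC.sqrt X := fun X =>
    (nonneg_iff_posSemidef.mp (CFC.sqrt_nonneg X)).1
  conv_lhs => rw [← CFC.sqrt_mul_sqrt_self V hV.nonneg, ← CFC.sqrt_mul_sqrt_self W hW.nonneg]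
  simp only [conjTranspose_mul, hh]
  generalize CFC.sqrt V = v
  generalize CFC.sqrt W = w
  generalize CFC.sqrt d.scaling = s
  rw [show v * v * s * (w * w) * s = (v * v * s * w) * (w * s) by simp only [Matrix.mul_assoc],
    Matrix.trace_mul_comm]
  simp only [Matrix.mul_assoc]

theorem trace_le_mul_of_mem_thetaSet [Nonempty n] (hS : IsGraphOver S₀ S) {V W : Matrix n n ℂ}
    (hV : V.PosSemidef) (hW : W.PosSemidef) {lam mu : ℝ} (hlam : lam ∈ thetaSet S V)
    (hmu : mu ∈ thetaSet (graphCompl S₀ S) W) :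
    (V * CFC.sqrt d.scaling * W * CFC.sqrt d.scaling).trace ≤ ((lam * mu : ℝ) : ℂ) := by
  have hh : ∀ X : Matrix n n ℂ, (CFC.sqrt X)ᴴ = CFC.sqrt X := fun X =>
    (nonneg_iff_posSemidef.mp (CFC.sqrt_nonneg X)).1
  have hl0 := nonneg_of_mem_thetaSet hlam
  have hm0 := nonneg_of_mem_thetaSet hmu
  obtain ⟨p, Y, hY⟩ := exists_krausFeasible hlam
  obtain ⟨q, Z, hZ⟩ := exists_krausFeasible hmu
  rw [d.trace_eq_conjTranspose_mul_self hV hW]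
  set C := CFC.sqrt V * CFC.sqrt d.scaling * CFC.sqrt W with hC
  obtain ⟨t, ht⟩ : ∃ t : ℝ, (Cᴴ * C).trace = t := ⟨_, (norm_vecEquiv_sq C).symm⟩
  have ht0 : 0 ≤ t := by
    have := (posSemidef_conjTranspose_mul_self C).trace_nonneg
    rwa [ht, Complex.zero_le_real] at this
  have hupper := d.sum_norm_trace_sq_le hS hY hZ hl0 C
  rw [ht, ← Complex.ofReal_mul, ← Complex.ofReal_mul, Complex.real_le_real] at hupper
  -- Domination for Z at N = (√D √V C)†, then for Y at N = C Zₗ† √D.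
  have hlower : t ^ 2 ≤ ∑ l, ∑ k, ‖((Z l)ᴴ * CFC.sqrt d.scaling * Y k * C).trace‖ ^ 2 := by
    have e1 : t = ‖((CFC.sqrt d.scaling * CFC.sqrt V * C)ᴴ * CFC.sqrt W).trace‖ := by
      rw [← norm_trace_conjTranspose, conjTranspose_mul, conjTranspose_conjTranspose]
      have : (CFC.sqrt W)ᴴ * (CFC.sqrt d.scaling * CFC.sqrt V * C) = Cᴴ * C := by
        rw [hC]; simp only [conjTranspose_mul, hh, Matrix.mul_assoc]
      rw [this, ht, Complex.norm_real, Real.norm_of_nonneg ht0]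
    rw [e1]
    refine (hZ.dominates _).trans (Finset.sum_le_sum fun l _ => ?_)
    have e2 : ‖((CFC.sqrt d.scaling * CFC.sqrt V * C)ᴴ * Z l).trace‖ =
        ‖(C * (Z l)ᴴ * CFC.sqrt d.scaling * CFC.sqrt V).trace‖ := by
      rw [← norm_trace_conjTranspose, conjTranspose_mul, conjTranspose_conjTranspose,
        ← Matrix.mul_assoc, Matrix.trace_mul_comm]
      simp only [Matrix.mul_assoc]
    rw [e2]
    refine (hY.dominates _).trans (le_of_eq (Finset.sum_congr rfl fun k _ => ?_))
    rw [Matrix.mul_assoc, Matrix.mul_assoc, Matrix.trace_mul_comm]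
    simp only [Matrix.mul_assoc]
  rw [ht, Complex.real_le_real]
  rcases ht0.eq_or_lt with h | h
  · rw [← h]; positivity
  · exact le_of_mul_le_mul_right (by nlinarith [hlower.trans hupper]) h

end BlockDecomposition

end Duality
end WeightedTheta

namespace WeightedTheta
open Matrix

/-! ### Dual optimal solutions by separation. -/

section StrictDuality

variable {m : Type*} [Fintype m]

/-- Matrices whose Hermitian part is positive definite. -/
def strictlyAccretive (m : Type*) [Fintype m] : Set (Matrix m m ℂ) :=
  {P | ∀ x ∈ Metric.sphere (0 : m → ℂ) 1, 0 < (star x ⬝ᵥ (P *ᵥ x)).re}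

lemma isOpen_strictlyAccretive : IsOpen (strictlyAccretive m) := by
  rw [isOpen_iff_eventually]
  intro P hP
  refine IsCompact.eventually_forall_of_forall_eventually (isCompact_sphere _ _) fun x hx => ?_
  have hcont : Continuous fun z : Matrix m m ℂ × (m → ℂ) => (star z.2 ⬝ᵥ (z.1 *ᵥ z.2)).re := by
    fun_prop
  exact hcont.continuousAt.eventually (lt_mem_nhds (hP x hx))

lemma convex_strictlyAccretive : Convex ℝ (strictlyAccretive m) := by
  intro P hP R hR a b ha hb hab x hx
  have h1 := hP x hx
  have h2 := hR x hx
  rw [add_mulVec, dotProduct_add, smul_mulVec, smul_mulVec, dotProduct_smul, dotProduct_smul,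
    Complex.add_re, Complex.smul_re, Complex.smul_re, smul_eq_mul, smul_eq_mul]
  rcases ha.eq_or_lt with h | h
  · have : b = 1 := by linarith
    simp [← h, this, h2]
  · have := mul_pos h h1
    have := mul_nonneg hb h2.le
    linarith

lemma smul_mem_strictlyAccretive {P : Matrix m m ℂ} (hP : P ∈ strictlyAccretive m) {r : ℝ}
    (hr : 0 < r) : r • P ∈ strictlyAccretive m := by
  intro x hx
  rw [smul_mulVec, dotProduct_smul, Complex.smul_re]
  exact mul_pos hr (hP x hx)

lemma re_dotProduct_nonneg_of_mem_strictlyAccretive {P : Matrix m m ℂ}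
    (hP : P ∈ strictlyAccretive m) (x : m → ℂ) : 0 ≤ (star x ⬝ᵥ (P *ᵥ x)).re := by
  by_cases hx : x = 0
  · simp [hx]
  have hn : ‖x‖ ≠ 0 := norm_ne_zero_iff.mpr hx
  have h := hP (‖x‖⁻¹ • x) (by simp [norm_smul, hn])
  rw [mulVec_smul, star_smul, dotProduct_smul, smul_dotProduct, Complex.smul_re, Complex.smul_re,
    star_trivial, smul_eq_mul, smul_eq_mul, ← mul_assoc] at h
  exact (pos_of_mul_pos_right h (by positivity)).le

lemma re_star_dotProduct_conjTranspose_mulVec (P : Matrix m m ℂ) (x : m → ℂ) :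
    star x ⬝ᵥ (Pᴴ *ᵥ x) = star (star x ⬝ᵥ (P *ᵥ x)) := by
  rw [← star_dotProduct, star_mulVec, ← dotProduct_mulVec]

lemma posSemidef_of_mem_strictlyAccretive {P : Matrix m m ℂ} (hP : P ∈ strictlyAccretive m) :
    (P + Pᴴ).PosSemidef := by
  refine PosSemidef.of_dotProduct_mulVec_nonneg (by simp [IsHermitian, add_comm]) fun x => ?_
  have := re_dotProduct_nonneg_of_mem_strictlyAccretive hP x
  rw [add_mulVec, dotProduct_add, re_star_dotProduct_conjTranspose_mulVec, Complex.star_def,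
    Complex.add_conj, Complex.zero_le_real]
  positivity

variable [DecidableEq m]

lemma add_smul_one_mem_strictlyAccretive {P : Matrix m m ℂ}
    (hP : ∀ x, 0 ≤ (star x ⬝ᵥ (P *ᵥ x)).re) {r : ℝ} (hr : 0 < r) :
    P + r • 1 ∈ strictlyAccretive m := by
  intro x hx
  have hx0 : x ≠ 0 := by
    rintro rfl
    simp at hx
  have h : 0 < (star x ⬝ᵥ x).re := (Complex.lt_def.mp (dotProduct_star_self_pos_iff.mpr hx0)).1
  rw [add_mulVec, dotProduct_add, smul_mulVec, dotProduct_smul, one_mulVec, Complex.add_re,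
    Complex.smul_re, smul_eq_mul]
  have := mul_pos hr h
  linarith [hP x]

lemma one_mem_strictlyAccretive : (1 : Matrix m m ℂ) ∈ strictlyAccretive m := by
  have := add_smul_one_mem_strictlyAccretive (m := m) (P := 0) (by simp) one_pos
  simpa using this

lemma nonneg_of_forall_pos_add_mul_nonneg {a b : ℝ} (h : ∀ r : ℝ, 0 < r → 0 ≤ a + r * b) :
    0 ≤ a := by
  by_contra! ha
  have hb : 0 < b := by nlinarith [h 1 one_pos]
  have h1 := h (-a / (2 * b)) (by apply div_pos <;> linarith)
  have : -a / (2 * b) * b = -a / 2 := by field_simp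
  linarith

/-- The cone leaves skew-Hermitian parts free, so a functional nonnegative on it must have Hermitian
`Q`: testing with 1, i and -i times a rank-one projector makes the quadratic form of `Q` real and
nonnegative. -/
lemma posSemidef_of_re_trace_mul_nonneg {Q : Matrix m m ℂ}
    (h : ∀ P ∈ strictlyAccretive m, 0 ≤ (Q * P).trace.re) : Q.PosSemidef := by
  have h1 : ∀ P : Matrix m m ℂ, (∀ x, 0 ≤ (star x ⬝ᵥ (P *ᵥ x)).re) → 0 ≤ (Q * P).trace.re := by
    intro P hP
    refine nonneg_of_forall_pos_add_mul_nonneg (b := Q.trace.re) fun r hr => ?_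
    have := h _ (add_smul_one_mem_strictlyAccretive hP hr)
    rwa [Matrix.mul_add, Matrix.mul_smul, Matrix.mul_one, Matrix.trace_add, Matrix.trace_smul,
      Complex.add_re, Complex.smul_re, smul_eq_mul] at this
  have h2 : ∀ (c : ℂ) (x : m → ℂ), 0 ≤ c.re → 0 ≤ (c * (star x ⬝ᵥ (Q *ᵥ x))).re := by
    intro c x hc
    have := h1 (c • ketBra x) fun y => by
      rw [smul_mulVec, dotProduct_smul, dotProduct_ketBra, smul_eq_mul, Complex.re_mul_ofReal]
      positivity
    rwa [Matrix.mul_smul, Matrix.trace_smul, ketBra, mul_vecMulVec, trace_vecMulVec,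
      dotProduct_comm, smul_eq_mul] at this
  have h3 : ∀ x : m → ℂ, 0 ≤ star x ⬝ᵥ (Q *ᵥ x) := by
    intro x
    have e1 := h2 1 x (by simp)
    have e2 := h2 Complex.I x (by simp)
    have e3 := h2 (-Complex.I) x (by simp)
    simp at e1 e2 e3
    exact Complex.nonneg_iff.mpr ⟨e1, le_antisymm e3 e2⟩
  rw [← isPositive_toEuclideanLin_iff, LinearMap.isPositive_iff_complex]
  intro x
  have e : inner ℂ (toEuclideanLin Q x) x = star x.ofLp ⬝ᵥ (Q *ᵥ x.ofLp) := by
    rw [EuclideanSpace.inner_eq_star_dotProduct, toLpLin_apply, dotProduct_comm, star_dotProduct]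
    have := Complex.nonneg_iff.mp (h3 x.ofLp)
    exact Complex.conj_eq_iff_im.mpr this.2.symm
  have h4 := Complex.nonneg_iff.mp (h3 x.ofLp)
  rw [e]
  exact ⟨Complex.ext (by simp) (by simp [← h4.2]), h4.1⟩

lemma exists_trace_eq (g : Matrix m m ℂ →ₗ[ℂ] ℂ) : ∃ Q : Matrix m m ℂ, ∀ X, g X = (Q * X).trace := by
  refine ⟨of fun i j => g (single j i 1), fun X => ?_⟩
  conv_lhs => rw [matrix_eq_sum_single X]
  have h : ∀ i j, single i j (X i j) = X i j • single i j (1 : ℂ) := fun i j => by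
    rw [smul_single, smul_eq_mul, mul_one]
  simp only [h, map_sum, map_smul, smul_eq_mul, Matrix.trace, Matrix.diag, Matrix.mul_apply,
    of_apply]
  rw [Finset.sum_comm]
  exact Finset.sum_congr rfl fun i _ => Finset.sum_congr rfl fun j _ => mul_comm _ _

lemma eq_zero_of_forall_re_mul_le {z : ℂ} {K : ℝ} (h : ∀ c : ℂ, (c * z).re ≤ K) : z = 0 := by
  by_contra hz
  have hp : 0 < Complex.normSq z := Complex.normSq_pos.mpr hz
  have := h (((|K| + 1) / Complex.normSq z : ℝ) * star z)
  rw [mul_assoc, mul_comm (star z), Complex.star_def, Complex.mul_conj, ← Complex.ofReal_mul,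
    Complex.ofReal_re, div_mul_cancel₀ _ hp.ne'] at this
  linarith [le_abs_self K]

variable {n : Type*} [Fintype n] [DecidableEq n] {S : Submodule ℂ (Matrix n n ℂ)}

lemma conjTranspose_mem_tensorFull (hS : IsNCGraph S) {Y : Matrix (n × n) (n × n) ℂ}
    (hY : Y ∈ tensorFull S) : Yᴴ ∈ tensorFull S := by
  rw [mem_tensorFull] at *
  exact fun b b' => hS.conjTranspose_mem _ (hY b' b)

lemma one_mem_tensorFull (hS : IsNCGraph S) : (1 : Matrix (n × n) (n × n) ℂ) ∈ tensorFull S :=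
  Submodule.subset_span ⟨1, hS.one_mem, 1, one_kronecker_one.symm⟩

/-- The partial trace as a linear map. -/
def partialTraceLinear (n : Type*) [Fintype n] :
    Matrix (n × n) (n × n) ℂ →ₗ[ℂ] Matrix n n ℂ where
  toFun := partialTraceA
  map_add' Y Z := by ext i j; simp [partialTraceA, Finset.sum_add_distrib]
  map_smul' c Y := by ext i j; simp [partialTraceA, Finset.mul_sum]

lemma partialTraceLinear_apply (Y : Matrix (n × n) (n × n) ℂ) :
    partialTraceLinear n Y = partialTraceA Y := rfl

lemma partialTraceA_conjTranspose (Y : Matrix (n × n) (n × n) ℂ) :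
    partialTraceA Yᴴ = (partialTraceA Y)ᴴ := by
  ext i j; simp [partialTraceA]

/-- The constraint slacks of the program defining a theta function, below the value `τ`. -/
def slackSet (S : Submodule ℂ (Matrix n n ℂ)) (v : n × n → ℂ) (τ : ℝ) :
    Set (Matrix n n ℂ × Matrix (n × n) (n × n) ℂ) :=
  {p | ∃ (lam : ℝ) (Y : Matrix (n × n) (n × n) ℂ), lam < τ ∧ Y ∈ tensorFull S ∧
    p = ((lam : ℂ) • 1 - partialTraceA Y, Y - ketBra v)}

lemma convex_slackSet (S : Submodule ℂ (Matrix n n ℂ)) (v : n × n → ℂ) (τ : ℝ) :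
    Convex ℝ (slackSet S v τ) := by
  rintro _ ⟨l, Y, hl, hY, rfl⟩ _ ⟨l', Y', hl', hY', rfl⟩ a b ha hb hab
  refine ⟨a * l + b * l', a • Y + b • Y', ?_, ?_, ?_⟩
  · exact (convex_Iio (𝕜 := ℝ) τ) hl hl' ha hb hab
  · exact ((tensorFull S).restrictScalars ℝ).add_mem
      (((tensorFull S).restrictScalars ℝ).smul_mem a hY)
      (((tensorFull S).restrictScalars ℝ).smul_mem b hY')
  · have hb' : b = 1 - a := by linarith
    have h1 : partialTraceA (a • Y + b • Y') = a • partialTraceA Y + b • partialTraceA Y' := by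
      ext i j; simp [partialTraceA, Finset.sum_add_distrib, Finset.mul_sum]
    rw [h1, hb']
    ext i j
    · simp; ring
    · simp; ring

/-- At a common point the Hermitian part of `Y` would be feasible, since S = S†, with a value below
the infimum. -/
lemma disjoint_slackSet [Nonempty n] (hS : IsNCGraph S) (W : Matrix n n ℂ) :
    Disjoint (strictlyAccretive n ×ˢ strictlyAccretive (n × n))
      (slackSet S (vectorize (CFC.sqrt W)) (theta S W)) := by
  set v := vectorize (CFC.sqrt W)
  rw [Set.disjoint_left]
  rintro _ ⟨h1, h2⟩ ⟨lam, Y, hl, hY, rfl⟩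
  have h1' := posSemidef_of_mem_strictlyAccretive h1
  have h2' := posSemidef_of_mem_strictlyAccretive h2
  have hhalf : (0 : ℂ) ≤ 1 / 2 := by
    rw [show (1 / 2 : ℂ) = ((1 / 2 : ℝ) : ℂ) by push_cast; rfl, Complex.zero_le_real]
    norm_num
  refine absurd (csInf_le (bddBelow_thetaSet S W) ?_) (not_le.mpr hl)
  refine ⟨(1 / 2 : ℂ) • (Y + Yᴴ), (tensorFull S).smul_mem _
    ((tensorFull S).add_mem hY (conjTranspose_mem_tensorFull hS hY)), ?_, ?_⟩
  · have e : (lam : ℂ) • (1 : Matrix n n ℂ) - partialTraceA ((1 / 2 : ℂ) • (Y + Yᴴ)) =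
        (1 / 2 : ℂ) • ((lam : ℂ) • 1 - partialTraceA Y +
          ((lam : ℂ) • 1 - partialTraceA Y)ᴴ) := by
      rw [← partialTraceLinear_apply, map_smul, map_add, partialTraceLinear_apply,
        partialTraceLinear_apply, partialTraceA_conjTranspose, conjTranspose_sub,
        conjTranspose_smul, conjTranspose_one, Complex.star_def, Complex.conj_ofReal]
      module
    rw [e]
    exact h1'.smul hhalf
  · have e : (1 / 2 : ℂ) • (Y + Yᴴ) - ketBra v =
        (1 / 2 : ℂ) • (Y - ketBra v + (Y - ketBra v)ᴴ) := by
      have : (ketBra v)ᴴ = ketBra v := (posSemidef_vecMulVec_self_star v).1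
      rw [conjTranspose_sub, this]
      module
    exact e ▸ h2'.smul hhalf

lemma exists_separation {m m' : Type*} [Fintype m] [DecidableEq m] [Fintype m'] [DecidableEq m']
    {t : Set (Matrix m m ℂ × Matrix m' m' ℂ)} (ht : Convex ℝ t)
    (hd : Disjoint (strictlyAccretive m ×ˢ strictlyAccretive m') t) :
    ∃ (ρ : Matrix m m ℂ) (Q : Matrix m' m' ℂ) (u : ℝ),
      (∀ P ∈ strictlyAccretive m, ∀ R ∈ strictlyAccretive m',
        0 < u + ((ρ * P).trace.re + (Q * R).trace.re)) ∧
      ∀ P R, (P, R) ∈ t → u + ((ρ * P).trace.re + (Q * R).trace.re) ≤ 0 := by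
  have hc : Convex ℝ (strictlyAccretive m ×ˢ strictlyAccretive m') :=
    convex_strictlyAccretive.prod convex_strictlyAccretive
  have ho : IsOpen (strictlyAccretive m ×ˢ strictlyAccretive m') :=
    isOpen_strictlyAccretive.prod isOpen_strictlyAccretive
  obtain ⟨f, u, hfs, hft⟩ := RCLike.geometric_hahn_banach_open (𝕜 := ℂ)
    (E := Matrix m m ℂ × Matrix m' m' ℂ) hc ho ht hd
  obtain ⟨ρ, hρ⟩ := exists_trace_eq (-(f.toLinearMap ∘ₗ LinearMap.inl ℂ _ _))
  obtain ⟨Q, hQ⟩ := exists_trace_eq (-(f.toLinearMap ∘ₗ LinearMap.inr ℂ _ _))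
  have hf : ∀ P R, f (P, R) = -((ρ * P).trace + (Q * R).trace) := by
    intro P R
    rw [← hρ, ← hQ]
    simp only [LinearMap.neg_apply, LinearMap.comp_apply, LinearMap.inl_apply,
      LinearMap.inr_apply, ContinuousLinearMap.coe_coe]
    rw [← neg_add, neg_neg, ← map_add]
    simp
  simp only [RCLike.re_to_complex] at hfs hft
  refine ⟨ρ, Q, u, fun P hP R hR => ?_, fun P R h => ?_⟩
  · have := hfs (P, R) ⟨hP, hR⟩
    rw [hf, Complex.neg_re, Complex.add_re] at this
    linarith
  · have := hft (P, R) h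
    rw [hf, Complex.neg_re, Complex.add_re] at this
    linarith

/-- Dual optimal solutions of the semidefinite program defining `θ(S, W)`. -/
lemma exists_dual_solution [Nonempty n] (hS : IsNCGraph S) (W : Matrix n n ℂ) :
    ∃ (ρ : Matrix n n ℂ) (Q : Matrix (n × n) (n × n) ℂ), ρ.PosSemidef ∧ Q.PosSemidef ∧ ρ ≠ 0 ∧
      (∀ Y ∈ tensorFull S, (Q * Y).trace = (ρ * partialTraceA Y).trace) ∧
      theta S W * ρ.trace.re ≤ (Q * ketBra (vectorize (CFC.sqrt W))).trace.re := by
  set v := vectorize (CFC.sqrt W)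
  obtain ⟨ρ, Q, u, hfs, hft⟩ := exists_separation (convex_slackSet S v (theta S W))
    (disjoint_slackSet hS W)
  have hscale : ∀ P ∈ strictlyAccretive n, ∀ R ∈ strictlyAccretive (n × n), ∀ r : ℝ, 0 < r →
      0 < u + r * ((ρ * P).trace.re + (Q * R).trace.re) := by
    intro P hP R hR r hr
    have := hfs _ (smul_mem_strictlyAccretive hP hr) _ (smul_mem_strictlyAccretive hR hr)
    rw [Matrix.mul_smul, Matrix.mul_smul, Matrix.trace_smul, Matrix.trace_smul,
      Complex.smul_re, Complex.smul_re, smul_eq_mul, smul_eq_mul] at this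
    linarith
  have hu : 0 ≤ u := nonneg_of_forall_pos_add_mul_nonneg fun r hr =>
    (hscale 1 one_mem_strictlyAccretive 1 one_mem_strictlyAccretive r hr).le
  -- Scaling the cone element to infinity removes the constant `u`.
  have hpos : ∀ P ∈ strictlyAccretive n, ∀ R ∈ strictlyAccretive (n × n),
      0 ≤ (ρ * P).trace.re + (Q * R).trace.re := by
    intro P hP R hR
    refine nonneg_of_forall_pos_add_mul_nonneg (b := u) fun r hr => ?_
    have := mul_pos hr (hscale P hP R hR r⁻¹ (inv_pos.mpr hr))
    rw [mul_add, ← mul_assoc, mul_inv_cancel₀ hr.ne', one_mul] at this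
    linarith
  have hρp : ρ.PosSemidef := posSemidef_of_re_trace_mul_nonneg fun P hP =>
    nonneg_of_forall_pos_add_mul_nonneg (b := Q.trace.re) fun r hr => by
      have := hpos P hP _ (smul_mem_strictlyAccretive one_mem_strictlyAccretive hr)
      rwa [Matrix.mul_smul, Matrix.mul_one, Matrix.trace_smul, Complex.smul_re] at this
  have hQp : Q.PosSemidef := posSemidef_of_re_trace_mul_nonneg fun R hR =>
    nonneg_of_forall_pos_add_mul_nonneg (b := ρ.trace.re) fun r hr => by
      have := hpos _ (smul_mem_strictlyAccretive one_mem_strictlyAccretive hr) R hR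
      rwa [Matrix.mul_smul, Matrix.mul_one, Matrix.trace_smul, Complex.smul_re, add_comm] at this
  have hmain : ∀ lam < theta S W, ∀ Y ∈ tensorFull S,
      u + lam * ρ.trace.re + ((Q * Y).trace - (ρ * partialTraceA Y).trace).re ≤
        (Q * ketBra v).trace.re := by
    intro lam hl Y hY
    have := hft _ _ ⟨lam, Y, hl, hY, rfl⟩
    rw [Matrix.mul_sub, Matrix.mul_sub, Matrix.trace_sub, Matrix.trace_sub, Matrix.mul_smul,
      Matrix.mul_one, Matrix.trace_smul, smul_eq_mul,
      Complex.sub_re, Complex.sub_re, Complex.re_ofReal_mul] at this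
    rw [Complex.sub_re]
    linarith
  -- `Y` ranges over a complex subspace, on which a linear functional with real part bounded above
  -- vanishes.
  have heq : ∀ Y ∈ tensorFull S, (Q * Y).trace = (ρ * partialTraceA Y).trace := by
    intro Y hY
    refine sub_eq_zero.mp (eq_zero_of_forall_re_mul_le
      (K := (Q * ketBra v).trace.re - u - (theta S W - 1) * ρ.trace.re) fun c => ?_)
    have := hmain (theta S W - 1) (by linarith) (c • Y) ((tensorFull S).smul_mem c hY)
    rw [← partialTraceLinear_apply, map_smul, partialTraceLinear_apply, Matrix.mul_smul,
      Matrix.mul_smul, Matrix.trace_smul, Matrix.trace_smul, smul_eq_mul, smul_eq_mul,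
      ← mul_sub] at this
    linarith
  refine ⟨ρ, Q, hρp, hQp, ?_, heq, ?_⟩
  -- Slater's condition: the identity lies in S ⊗ L(B), so ρ = 0 forces Tr Q = 0 and Q = 0, and then
  -- the two separation inequalities give 0 < u ≤ 0.
  · intro h0
    have hQ0 : Q = 0 := by
      have := heq 1 (one_mem_tensorFull hS)
      rw [h0, Matrix.zero_mul, Matrix.mul_one, Matrix.trace_zero] at this
      exact hQp.trace_eq_zero_iff.mp this
    have h1 := hscale 1 one_mem_strictlyAccretive 1 one_mem_strictlyAccretive 1 one_pos
    have h2 := hmain (theta S W - 1) (by linarith) 0 (Submodule.zero_mem _)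
    simp [h0, hQ0] at h1 h2
    linarith
  · refine le_of_forall_pos_le_add fun ε hε => ?_
    -- `lam` must stay strictly below θ; this gap costs at most ε after multiplication by Tr ρ.
    have hε' : 0 < ε / (ρ.trace.re + 1) := by
      have := (Complex.nonneg_iff.mp hρp.trace_nonneg).1
      positivity
    have hr := (Complex.nonneg_iff.mp hρp.trace_nonneg).1
    have h2 := hmain (theta S W - ε / (ρ.trace.re + 1)) (by linarith) 0 (Submodule.zero_mem _)
    have h3 : ε / (ρ.trace.re + 1) * ρ.trace.re ≤ ε := by
      rw [div_mul_eq_mul_div, div_le_iff₀ (by linarith)]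
      nlinarith
    rw [← partialTraceLinear_apply, map_zero, Matrix.mul_zero, Matrix.mul_zero, Matrix.trace_zero,
      Matrix.trace_zero, sub_zero, Complex.zero_re] at h2
    nlinarith

end StrictDuality
end WeightedTheta

namespace WeightedTheta
open Matrix

/-! ### The inequality for theta, and attainment of equality. -/

section Attainment

variable {n : Type*} [Fintype n] [DecidableEq n] {S₀ : StarSubalgebra ℂ (Matrix n n ℂ)}
  {S : Submodule ℂ (Matrix n n ℂ)}

lemma norm_trace_conjTranspose_mul_sq_le (A B : Matrix n n ℂ) :
    ‖(Aᴴ * B).trace‖ ^ 2 ≤ (Aᴴ * A).trace.re * (Bᴴ * B).trace.re := by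
  have h := norm_inner_le_norm (𝕜 := ℂ) (vecEquiv n A) (vecEquiv n B)
  rw [inner_vecEquiv] at h
  rw [← norm_vecEquiv_sq, ← norm_vecEquiv_sq, Complex.ofReal_re, Complex.ofReal_re, ← mul_pow]
  exact pow_le_pow_left₀ (norm_nonneg _) h 2

lemma sum_single_conj (B : Matrix n n ℂ) :
    ∑ p : n × n, single p.1 p.2 (1 : ℂ) * B * (single p.1 p.2 (1 : ℂ))ᴴ = B.trace • 1 := by
  ext i j
  simp [Matrix.sum_apply, Fintype.sum_prod_type, Matrix.single_apply,
    Matrix.one_apply, ite_and, Matrix.trace]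

/-- The depolarizing map has values in ℂ·I ⊆ S and dominates by Cauchy–Schwarz. It shows that the
program is feasible, so that `theta` is not the default infimum of an empty set. -/
lemma krausFeasible_single (hS : IsNCGraph S) (M : Matrix n n ℂ) :
    KrausFeasible S M (‖vecEquiv n M‖ ^ 2 * Fintype.card n)
      fun p : n × n => (‖vecEquiv n M‖ : ℂ) • single p.1 p.2 (1 : ℂ) where
  mem B := by
    have : ∑ p : n × n, ((‖vecEquiv n M‖ : ℂ) • single p.1 p.2 (1 : ℂ)) * B *
        ((‖vecEquiv n M‖ : ℂ) • single p.1 p.2 (1 : ℂ))ᴴ =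
        ((‖vecEquiv n M‖ : ℂ) * ‖vecEquiv n M‖ * B.trace) • 1 := by
      simp only [conjTranspose_smul, Matrix.smul_mul, Matrix.mul_smul, smul_smul,
        ← Finset.smul_sum, sum_single_conj, Complex.star_def, Complex.conj_ofReal]
    rw [this]
    exact S.smul_mem _ hS.one_mem
  bound := by
    have : ∑ p : n × n, ((‖vecEquiv n M‖ : ℂ) • single p.1 p.2 (1 : ℂ))ᴴ *
        ((‖vecEquiv n M‖ : ℂ) • single p.1 p.2 (1 : ℂ)) =
        ((‖vecEquiv n M‖ ^ 2 * Fintype.card n : ℝ) : ℂ) • 1 := by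
      simp only [conjTranspose_smul, Matrix.smul_mul, Matrix.mul_smul, smul_smul,
        ← Finset.smul_sum, sum_conjTranspose_single_mul_single, Complex.star_def,
        Complex.conj_ofReal]
      push_cast
      rw [pow_two]
    rw [this, sub_self]
    exact PosSemidef.zero
  dominates N := by
    have h := norm_trace_conjTranspose_mul_sq_le Nᴴ M
    rw [conjTranspose_conjTranspose, ← norm_vecEquiv_sq M, Complex.ofReal_re, mul_comm] at h
    refine h.trans (le_of_eq ?_)
    have e : (N * Nᴴ).trace.re = ∑ p : n × n, ‖N p.2 p.1‖ ^ 2 := by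
      simp only [Matrix.trace, Matrix.diag, Matrix.mul_apply, conjTranspose_apply,
        Complex.star_def, Complex.mul_conj, Complex.normSq_eq_norm_sq, Fintype.sum_prod_type]
      rw [Finset.sum_comm, ← Complex.ofReal_re (∑ x, ∑ y, ‖N y x‖ ^ 2)]
      push_cast
      rfl
    rw [e, Finset.mul_sum]
    refine Finset.sum_congr rfl fun p _ => ?_
    rw [Matrix.mul_smul, Matrix.trace_smul, Matrix.trace_mul_single, norm_smul, mul_pow]
    simp

lemma thetaSet_nonempty (hS : IsNCGraph S) (W : Matrix n n ℂ) : (thetaSet S W).Nonempty :=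
  ⟨_, (krausFeasible_single hS _).mem_thetaSet⟩

lemma le_sInf_mul_of_forall_le {s : Set ℝ} {a x : ℝ} (ha : 0 ≤ a) (hne : s.Nonempty) (h : ∀ b ∈ s, x ≤ b * a) : x ≤ sInf s * a := by
  rcases ha.eq_or_lt with h0 | h0
  · obtain ⟨b, hb⟩ := hne
    simpa [← h0] using h b hb
  · rw [← div_le_iff₀ h0]
    exact le_csInf hne fun b hb => (div_le_iff₀ h0).mpr (h b hb)

theorem BlockDecomposition.trace_le_theta_mul_theta [Nonempty n] (d : BlockDecomposition S₀)
    (hS : IsGraphOver S₀ S) {V W : Matrix n n ℂ} (hV : V.PosSemidef) (hW : W.PosSemidef) :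
    (V * CFC.sqrt d.scaling * W * CFC.sqrt d.scaling).trace ≤
      ((theta S V * theta (graphCompl S₀ S) W : ℝ) : ℂ) := by
  obtain ⟨t, ht⟩ : ∃ t : ℝ, (V * CFC.sqrt d.scaling * W * CFC.sqrt d.scaling).trace = t :=
    ⟨_, (d.trace_eq_conjTranspose_mul_self hV hW).trans (norm_vecEquiv_sq _).symm⟩
  rw [ht, Complex.real_le_real]
  have hne := thetaSet_nonempty hS.isNCGraph V
  have hne' := thetaSet_nonempty hS.graphCompl.isNCGraph W
  have h : ∀ lam ∈ thetaSet S V, ∀ mu ∈ thetaSet (graphCompl S₀ S) W, t ≤ lam * mu := by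
    intro lam hlam mu hmu
    have := d.trace_le_mul_of_mem_thetaSet hS hV hW hlam hmu
    rwa [ht, Complex.real_le_real] at this
  refine le_sInf_mul_of_forall_le (theta_nonneg _ _) hne fun lam hlam => ?_
  rw [mul_comm]
  exact le_sInf_mul_of_forall_le (nonneg_of_mem_thetaSet hlam) hne'
    fun mu hmu => by rw [mul_comm]; exact h lam hlam mu hmu

lemma trace_mul_ketBra {m : Type*} [Fintype m] (M : Matrix m m ℂ) (v : m → ℂ) :
    (M * ketBra v).trace = star v ⬝ᵥ (M *ᵥ v) := by
  rw [ketBra, mul_vecMulVec, trace_vecMulVec, dotProduct_comm]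

lemma trace_choi_mul_kronecker {ι : Type*} [Fintype ι] (q : ι → Matrix n n ℂ)
    (X B : Matrix n n ℂ) :
    (choi q * (X ⊗ₖ Bᵀ)).trace = (X * ∑ k, q k * B * (q k)ᴴ).trace := by
  rw [choi, Matrix.sum_mul, Matrix.mul_sum, Matrix.trace_sum, Matrix.trace_sum]
  refine Finset.sum_congr rfl fun k _ => ?_
  have e : (fun p : n × n => q k p.1 p.2) = vec (q k)ᵀ := rfl
  rw [Matrix.trace_mul_comm, trace_mul_ketBra, e, kronecker_mulVec_vec, star_vec_dotProduct_vec,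
    ← trace_transpose]
  simp only [transpose_mul, transpose_transpose, Matrix.mul_assoc]
  rfl

/-- The dual solution `Q` read as a Choi matrix; testing on `X ⊗ₖ Bᵀ` gives the trace identity, with
the dual state transposed. -/
lemma exists_dual_kraus [Nonempty n] (hS : IsNCGraph S) (W : Matrix n n ℂ) :
    ∃ (ρ : Matrix n n ℂ) (m : ℕ) (q : Fin m → Matrix n n ℂ), ρ.PosSemidef ∧ ρ ≠ 0 ∧
      (∀ X ∈ S, ∀ B, (X * ∑ k, q k * B * (q k)ᴴ).trace = X.trace * (ρ * B).trace) ∧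
      theta S W * ρ.trace.re ≤ ∑ k, ‖((q k)ᴴ * CFC.sqrt W).trace‖ ^ 2 := by
  obtain ⟨ρ, Q, hρ, hQ, hρ0, h1, h2⟩ := exists_dual_solution hS W
  obtain ⟨m, q, rfl⟩ := exists_choi_eq hQ
  refine ⟨ρᵀ, m, q, hρ.transpose, by simpa using hρ0, fun X hX B => ?_, ?_⟩
  · have h3 := h1 (X ⊗ₖ Bᵀ) (Submodule.subset_span ⟨X, hX, _, rfl⟩)
    have e2 : partialTraceA (X ⊗ₖ Bᵀ) = X.trace • Bᵀ := by
      ext b b'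
      simp [partialTraceA, Matrix.trace, Finset.sum_mul]
    rw [trace_choi_mul_kronecker, e2, Matrix.mul_smul, Matrix.trace_smul,
      ← trace_transpose (ρ * Bᵀ), transpose_mul, transpose_transpose,
      Matrix.trace_mul_comm B] at h3
    exact h3
  · rw [trace_transpose]
    refine h2.trans (le_of_eq ?_)
    rw [choi, Matrix.sum_mul, Matrix.trace_sum, Complex.re_sum]
    refine Finset.sum_congr rfl fun k _ => ?_
    have e : vectorize (CFC.sqrt W) = fun p => CFC.sqrt W p.1 p.2 := funext (vectorize_apply _)
    rw [trace_mul_ketBra, dotProduct_ketBra, Complex.ofReal_re, ← norm_trace_conjTranspose,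
      conjTranspose_mul, conjTranspose_conjTranspose, trace_mul_eq_dotProduct, e]
    simp only [conjTranspose_apply, star_star]

lemma posSemidef_one_sub_of_idempotent {p : Matrix n n ℂ} (hp : p.IsHermitian) (hpp : p * p = p) :
    (1 - p).PosSemidef := by
  have : 1 - p = (1 - p)ᴴ * (1 - p) := by
    rw [conjTranspose_sub, conjTranspose_one, hp.eq]
    simp only [Matrix.mul_sub, Matrix.sub_mul, hpp, Matrix.one_mul, Matrix.mul_one]
    abel
  rw [this]
  exact posSemidef_conjTranspose_mul_self _

/-- Feasibility for `M` only depends on `M M†`. -/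
lemma KrausFeasible.sqrt {ι : Type*} [Fintype ι] {M : Matrix n n ℂ} {lam : ℝ}
    {Z : ι → Matrix n n ℂ} (h : KrausFeasible S M lam Z) (hlam : 0 ≤ lam) :
    ∃ u : Matrix n n ℂ, KrausFeasible S (CFC.sqrt (M * Mᴴ)) lam fun k => Z k * u := by
  obtain ⟨s, t, hs, ht, hss, hst, hsts, htst, -⟩ :=
    exists_sqrt_pseudoinverse (posSemidef_self_mul_conjTranspose M)
  have hsq : CFC.sqrt (M * Mᴴ) = s := CFC.sqrt_unique hss hs.nonneg
  -- `Mᴴ * t` is the partial isometry of the polar decomposition of `M`; its initial projection is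
  -- `t * s`, and adding `lam` times the complement of `t * s` restores the bound `lam`.
  have hMu : M * (Mᴴ * t) = s := by
    rw [← Matrix.mul_assoc, ← hss, Matrix.mul_assoc, hst, ← Matrix.mul_assoc, hsts]
  have huu : (Mᴴ * t)ᴴ * (Mᴴ * t) = t * s := by
    rw [conjTranspose_mul, conjTranspose_conjTranspose, ht.eq, Matrix.mul_assoc, hMu]
  have hp : (1 - t * s).PosSemidef := by
    refine posSemidef_one_sub_of_idempotent ?_ (by rw [← Matrix.mul_assoc, htst])
    rw [IsHermitian, conjTranspose_mul, ht.eq, hs.1.eq, hst]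
  refine ⟨Mᴴ * t, ⟨fun B => ?_, ?_, fun N => ?_⟩⟩
  · have := h.mem ((Mᴴ * t) * B * (Mᴴ * t)ᴴ)
    simpa only [conjTranspose_mul (Z _), Matrix.mul_assoc] using this
  · have h1 := (h.bound.conjTranspose_mul_mul_same (Mᴴ * t)).add
      (hp.smul (Complex.zero_le_real.mpr hlam))
    rw [← huu] at h1
    convert h1 using 1
    simp only [conjTranspose_mul (Z _), Matrix.mul_sub, Matrix.sub_mul, Matrix.mul_sum,
      Matrix.sum_mul, Matrix.mul_smul, Matrix.smul_mul, smul_sub, Matrix.mul_one,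
      Matrix.mul_assoc]
    abel
  · have := h.dominates (Mᴴ * t * N)
    rw [hsq, ← hMu]
    have e : ∀ X, (Mᴴ * t * N * X).trace = (N * (X * (Mᴴ * t))).trace := fun X => by
      rw [Matrix.mul_assoc (Mᴴ * t), Matrix.trace_mul_comm, Matrix.mul_assoc]
    simpa only [e] using this

lemma commutant_mul {X Y : Matrix n n ℂ} (hX : X ∈ commutant S₀) (hY : Y ∈ commutant S₀) :
    X * Y ∈ commutant S₀ := fun K hK => by
  rw [← Matrix.mul_assoc, hX K hK, Matrix.mul_assoc, hY K hK, Matrix.mul_assoc]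

lemma commutant_smul {X : Matrix n n ℂ} (hX : X ∈ commutant S₀) (c : ℂ) :
    c • X ∈ commutant S₀ := fun K hK => by
  rw [Matrix.mul_smul, Matrix.smul_mul, hX K hK]

lemma commutant_conjTranspose {X : Matrix n n ℂ} (hX : X ∈ commutant S₀) :
    Xᴴ ∈ commutant S₀ := fun K hK => by
  have := congrArg conjTranspose (hX _ (conjTranspose_mem_algebra hK))
  simpa using this.symm

lemma commutant_sqrt {X : Matrix n n ℂ} (hX : X.PosSemidef) (hc : X ∈ commutant S₀) :
    CFC.sqrt X ∈ commutant S₀ := fun K hK => by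
  obtain ⟨s, t, hs, -, hss, -, -, -, h⟩ := exists_sqrt_pseudoinverse hX
  rw [CFC.sqrt_unique hss hs.nonneg]
  exact (h K (hc K hK).symm).1.symm

namespace BlockDecomposition

variable (d : BlockDecomposition S₀)

/-- The right side has the form S₀ Φ(·) S₀, so projecting Kraus operators onto S₀' keeps the values
of the map in any S₀-bimodule. -/
lemma sum_expCommutant_conj {ι : Type*} [Fintype ι] (q : ι → Matrix n n ℂ) (B : Matrix n n ℂ) :
    ∑ k, d.expCommutant (q k) * B * (d.expCommutant (q k))ᴴ =
      ∑ g, ∑ h, ((d.weight g.1 : ℂ) * d.weight h.1) • (d.unitA g *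
        (∑ k, q k * ((d.unitA g)ᴴ * B * d.unitA h) * (q k)ᴴ) * (d.unitA h)ᴴ) := by
  simp only [expCommutant, conjTranspose_sum, conjTranspose_smul, conjTranspose_mul,
    conjTranspose_conjTranspose, Matrix.mul_sum, Matrix.sum_mul, Finset.smul_sum, Matrix.smul_mul,
    Matrix.mul_smul, smul_smul, Complex.star_def, Complex.conj_ofReal, Matrix.mul_assoc]
  conv_lhs =>
    rw [Finset.sum_comm]
    enter [2, h]
    rw [Finset.sum_comm]
  rw [Finset.sum_comm]
  exact Finset.sum_congr rfl fun g _ => Finset.sum_congr rfl fun h _ =>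
    Finset.sum_congr rfl fun k _ => by rw [mul_comm (d.weight h.1 : ℂ)]

lemma trace_expCommutant_conjTranspose_mul {X C : Matrix n n ℂ} (hC : C ∈ commutant S₀) :
    ((d.expCommutant X)ᴴ * C).trace = (Xᴴ * C).trace := by
  have h : (Xᴴ * C).trace =
      (Xᴴ * (∑ k, (d.weight k.1 : ℂ) • ((d.unitA k)ᴴ * d.unitA k)) * C).trace := by
    rw [d.sum_unitA_conjTranspose_mul, Matrix.mul_one]
  rw [h, expCommutant, conjTranspose_sum, Matrix.sum_mul, Matrix.mul_sum, Matrix.sum_mul,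
    Matrix.trace_sum, Matrix.trace_sum]
  refine Finset.sum_congr rfl fun k _ => ?_
  rw [conjTranspose_smul, Matrix.smul_mul, Matrix.mul_smul, Matrix.smul_mul, Matrix.trace_smul,
    Matrix.trace_smul, Complex.star_def, Complex.conj_ofReal, conjTranspose_mul, conjTranspose_mul,
    conjTranspose_conjTranspose, Matrix.mul_assoc (d.unitA k), Matrix.trace_mul_comm (d.unitA k)]
  congr 2
  rw [Matrix.mul_assoc, Matrix.mul_assoc, Matrix.mul_assoc, Matrix.mul_assoc,
    hC _ (d.unitA_mem k)]

lemma expCommutant_posSemidef {X : Matrix n n ℂ} (hX : X.PosSemidef) :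
    (d.expCommutant X).PosSemidef :=
  posSemidef_sum _ fun _ _ => (hX.mul_mul_conjTranspose_same _).smul
    (Complex.zero_le_real.mpr (d.weight_pos _).le)

lemma trace_expCommutant (X : Matrix n n ℂ) : (d.expCommutant X).trace = X.trace := by
  have h := d.trace_expCommutant_conjTranspose_mul (X := X) (C := 1) fun K _ => by
    rw [Matrix.mul_one, Matrix.one_mul]
  rwa [Matrix.mul_one, Matrix.mul_one, trace_conjTranspose, trace_conjTranspose, star_inj] at h

/-- The completely positive map of a dual solution has an explicit adjoint on `D⁻¹`. -/
lemma sum_expCommutant_conjTranspose_mul (hS : IsGraphOver S₀ S) {ι : Type*} [Fintype ι]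
    {q : ι → Matrix n n ℂ} {ρ : Matrix n n ℂ}
    (hq : ∀ X ∈ S, ∀ B, (X * ∑ k, q k * B * (q k)ᴴ).trace = X.trace * (ρ * B).trace) :
    ∑ k, (d.expCommutant (q k))ᴴ * (d.scalar fun i => (d.ratio i)⁻¹) * d.expCommutant (q k) =
      d.expCommutant ρ := by
  set R := d.scalar fun i => (d.ratio i)⁻¹ with hR
  refine Matrix.ext_iff_trace_mul_right.mpr fun B => ?_
  have hRS : ∀ g h, (d.unitA h)ᴴ * R * d.unitA g ∈ S := fun g h =>
    hS.vertexSpace_le (S₀.mul_mem (S₀.mul_mem (conjTranspose_mem_algebra (d.unitA_mem h))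
      (d.scalar_mem _)) (d.unitA_mem g))
  calc _ = (R * ∑ k, d.expCommutant (q k) * B * (d.expCommutant (q k))ᴴ).trace := by
        rw [Matrix.sum_mul, Matrix.mul_sum, Matrix.trace_sum, Matrix.trace_sum]
        refine Finset.sum_congr rfl fun k _ => ?_
        rw [Matrix.mul_assoc, Matrix.mul_assoc, Matrix.trace_mul_comm]
        simp only [Matrix.mul_assoc]
    _ = ∑ g, ∑ h, ((d.weight g.1 : ℂ) * d.weight h.1) * (((d.unitA h)ᴴ * R * d.unitA g) *
          ∑ k, q k * ((d.unitA g)ᴴ * B * d.unitA h) * (q k)ᴴ).trace := by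
        rw [d.sum_expCommutant_conj, Matrix.mul_sum, Matrix.trace_sum]
        refine Finset.sum_congr rfl fun g _ => ?_
        rw [Matrix.mul_sum, Matrix.trace_sum]
        refine Finset.sum_congr rfl fun h _ => ?_
        rw [Matrix.mul_smul, Matrix.trace_smul, smul_eq_mul, ← Matrix.mul_assoc,
          Matrix.trace_mul_comm]
        simp only [Matrix.mul_assoc]
    _ = ∑ g, (d.weight g.1 : ℂ) * (ρ * ((d.unitA g)ᴴ * B * d.unitA g)).trace := by
        refine Finset.sum_congr rfl fun g _ => ?_
        -- The sandwiched D⁻¹ lies in S₀ ⊆ S, so the dual identity applies, and orthogonality of the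
        -- units kills the terms with g ≠ h.
        rw [Finset.sum_eq_single g]
        · rw [hq _ (hRS g g), d.trace_unitA_conjTranspose_mul_scalar_mul, if_pos rfl]
          have : (d.weight g.1 : ℂ) ≠ 0 := by exact_mod_cast (d.weight_pos g.1).ne'
          field_simp
        · intro h _ hh
          rw [hq _ (hRS g h), d.trace_unitA_conjTranspose_mul_scalar_mul, if_neg hh]
          simp
        · simp
    _ = _ := by
        rw [expCommutant, Matrix.sum_mul, Matrix.trace_sum]
        refine Finset.sum_congr rfl fun g _ => ?_
        rw [Matrix.smul_mul, Matrix.trace_smul, smul_eq_mul, Matrix.mul_assoc (d.unitA g),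
          Matrix.mul_assoc (d.unitA g), Matrix.trace_mul_comm (d.unitA g)]
        simp only [Matrix.mul_assoc]

/-- Dual feasibility says exactly that Φ(B) − Tr(ρB)·I is orthogonal to S = S†. -/
lemma graphCompl_mem_of_dual (hS : IsGraphOver S₀ S) {ι : Type*} [Fintype ι]
    {q : ι → Matrix n n ℂ} {ρ : Matrix n n ℂ}
    (hq : ∀ X ∈ S, ∀ B, (X * ∑ k, q k * B * (q k)ᴴ).trace = X.trace * (ρ * B).trace)
    (B : Matrix n n ℂ) : ∑ k, q k * B * (q k)ᴴ ∈ graphCompl S₀ S := by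
  have h1 : (∑ k, q k * B * (q k)ᴴ) - (ρ * B).trace • 1 ∈ hsOrthogonal S := by
    intro Y hY
    rw [Matrix.mul_sub, Matrix.trace_sub, hq _ (hS.isNCGraph.conjTranspose_mem _ hY),
      Matrix.mul_smul, Matrix.mul_one, Matrix.trace_smul, smul_eq_mul, mul_comm, sub_self]
  rw [← sub_add_cancel (∑ k, q k * B * (q k)ᴴ) ((ρ * B).trace • 1)]
  exact Submodule.add_mem_sup h1 (Submodule.smul_mem _ _ (one_mem S₀ :))

lemma norm_sum_mul_sq_le {ι : Type*} [Fintype ι] {b : ι → ℂ} (hb : ∑ k, ‖b k‖ ^ 2 ≤ 1)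
    (x : ι → ℂ) : ‖∑ k, b k * x k‖ ^ 2 ≤ ∑ k, ‖x k‖ ^ 2 := by
  have h1 : ‖∑ k, b k * x k‖ ≤ ∑ k, ‖b k‖ * ‖x k‖ :=
    (norm_sum_le _ _).trans (le_of_eq (Finset.sum_congr rfl fun k _ => norm_mul _ _))
  have h2 := Finset.sum_mul_sq_le_sq_mul_sq Finset.univ (fun k => ‖b k‖) fun k => ‖x k‖
  have h3 : 0 ≤ ∑ k, ‖x k‖ ^ 2 := Finset.sum_nonneg fun k _ => by positivity
  calc ‖∑ k, b k * x k‖ ^ 2 ≤ (∑ k, ‖b k‖ * ‖x k‖) ^ 2 := pow_le_pow_left₀ (norm_nonneg _) h1 2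
    _ ≤ _ := h2
    _ ≤ 1 * ∑ k, ‖x k‖ ^ 2 := mul_le_mul_of_nonneg_right hb h3
    _ = _ := one_mul _

/-- The normalized, projected dual map is primal feasible for S^⊥ + S₀. Since √V lies in S₀', the
projection does not change its overlaps with the qₖ, so the dual value survives. -/
lemma exists_weight_of_theta_pos [Nonempty n] (hS : IsGraphOver S₀ S) {V : Matrix n n ℂ}
    (hV : V.PosSemidef) (hVc : V ∈ commutant S₀) (hpos : 0 < theta S V) :
    ∃ W : Matrix n n ℂ, W.PosSemidef ∧ W ∈ commutant S₀ ∧ theta (graphCompl S₀ S) W ≤ 1 ∧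
      theta S V ≤ (V * CFC.sqrt d.scaling * W * CFC.sqrt d.scaling).trace.re := by
  obtain ⟨ρ, m, q, hρ, hρ0, hq, hval⟩ := exists_dual_kraus hS.isNCGraph V
  have hρt : 0 < ρ.trace.re := by
    have h1 := Complex.nonneg_iff.mp hρ.trace_nonneg
    refine lt_of_le_of_ne h1.1 fun h => hρ0 (hρ.trace_eq_zero_iff.mp ?_)
    exact Complex.ext h.symm h1.2.symm
  obtain ⟨s, t, hs, ht, hss, hst, hsts, htst, hcomm⟩ :=
    exists_sqrt_pseudoinverse (d.expCommutant_posSemidef hρ)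
  have htc : t ∈ commutant S₀ := fun K hK =>
    (hcomm K (d.expCommutant_mem ρ K hK).symm).2.symm
  have hVs := commutant_sqrt hV hVc
  set R := d.scalar fun i => (√(d.ratio i))⁻¹ with hR
  have hRh : Rᴴ = R := d.conjTranspose_scalar _
  have hRR : R * R = d.scalar fun i => (d.ratio i)⁻¹ := by
    rw [hR, scalar_mul_scalar]
    congr 1; ext i
    rw [← mul_inv, Real.mul_self_sqrt (d.ratio_pos i).le]
  have hDR : CFC.sqrt d.scaling * R = 1 := by
    rw [sqrt_scaling, hR, scalar_mul_scalar, ← d.scalar_one]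
    congr 1; ext i
    exact mul_inv_cancel₀ (Real.sqrt_pos.mpr (d.ratio_pos i)).ne'
  set E := fun k => d.expCommutant (q k) with hE
  have hsum : ∑ k, (R * E k)ᴴ * (R * E k) = s * s := by
    rw [hss, ← d.sum_expCommutant_conjTranspose_mul hS hq]
    refine Finset.sum_congr rfl fun k _ => ?_
    rw [← hRR, conjTranspose_mul, hRh]
    simp only [hE, Matrix.mul_assoc]
  -- ∑ Eₖ†D⁻¹Eₖ = E(ρ) forces each Eₖ to vanish off the support of E(ρ), so the pseudo-inverse loses
  -- nothing.
  have hEp : ∀ k, E k * (t * s) = E k := by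
    have h0 : ∑ k, (R * E k * (1 - t * s))ᴴ * (R * E k * (1 - t * s)) = 0 := by
      have h1 : s * (1 - t * s) = 0 := by
        rw [Matrix.mul_sub, Matrix.mul_one, ← Matrix.mul_assoc, hsts, sub_self]
      calc _ = (1 - t * s)ᴴ * (∑ k, (R * E k)ᴴ * (R * E k)) * (1 - t * s) := by
            rw [Matrix.mul_sum, Matrix.sum_mul]
            refine Finset.sum_congr rfl fun k _ => ?_
            rw [conjTranspose_mul (R * E k)]
            simp only [Matrix.mul_assoc]
        _ = 0 := by rw [hsum, Matrix.mul_assoc, Matrix.mul_assoc s, h1]; simp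
    intro k
    have h1 := (Finset.sum_eq_zero_iff_of_nonneg fun k _ =>
      (posSemidef_conjTranspose_mul_self (R * E k * (1 - t * s))).nonneg).mp h0 k
        (Finset.mem_univ k)
    rw [conjTranspose_mul_self_eq_zero] at h1
    have h2 : CFC.sqrt d.scaling * (R * E k * (1 - t * s)) = E k * (1 - t * s) := by
      rw [← Matrix.mul_assoc, ← Matrix.mul_assoc, hDR, Matrix.one_mul]
    rw [h1, Matrix.mul_zero, Matrix.mul_sub, Matrix.mul_one] at h2
    exact (sub_eq_zero.mp h2.symm).symm
  set α : Fin m → ℂ := fun k => ((q k)ᴴ * CFC.sqrt V).trace with hα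
  set r := √(∑ k, ‖α k‖ ^ 2) with hr
  have hr2 : r ^ 2 = ∑ k, ‖α k‖ ^ 2 :=
    Real.sq_sqrt (Finset.sum_nonneg fun k _ => by positivity)
  have hrpos : 0 < r := Real.sqrt_pos.mpr ((mul_pos hpos hρt).trans_le hval)
  -- The unit vector along the overlaps is the case of equality in Cauchy–Schwarz, and gives Tr(√V
  -- √D M s) = r.
  set b : Fin m → ℂ := fun k => α k / r with hb
  have hb1 : ∑ k, ‖b k‖ ^ 2 = 1 := by
    simp only [hb, norm_div, div_pow, Complex.norm_real, Real.norm_eq_abs, sq_abs]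
    rw [← Finset.sum_div, ← hr2, div_self (pow_pos hrpos 2).ne']
  set Z : Fin m → Matrix n n ℂ := fun k => R * E k * t with hZ
  set M : Matrix n n ℂ := ∑ k, b k • Z k with hM
  have hMc : M ∈ commutant S₀ := commutant_sum fun k _ => commutant_smul
    (commutant_mul (commutant_mul (d.scalar_mem_commutant _) (d.expCommutant_mem _)) htc) _
  have hfeas : KrausFeasible (graphCompl S₀ S) M 1 Z := by
    refine ⟨fun B => ?_, ?_, fun N => ?_⟩
    · have h1 : ∑ k, Z k * B * (Z k)ᴴ =
          R * (∑ k, E k * (t * B * t) * (E k)ᴴ) * R := by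
        rw [Matrix.mul_sum, Matrix.sum_mul]
        refine Finset.sum_congr rfl fun k _ => ?_
        simp only [hZ, conjTranspose_mul, hRh, ht.eq, Matrix.mul_assoc]
      rw [h1]
      refine hS.graphCompl.mul_mul_mem (d.scalar_mem _) ?_ (d.scalar_mem _)
      rw [hE, d.sum_expCommutant_conj]
      refine Submodule.sum_mem _ fun g _ => Submodule.sum_mem _ fun h _ =>
        Submodule.smul_mem _ _ ?_
      exact hS.graphCompl.mul_mul_mem (d.unitA_mem g) (graphCompl_mem_of_dual hS hq _)
        (conjTranspose_mem_algebra (d.unitA_mem h))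
    · have h1 : ∑ k, (Z k)ᴴ * Z k = t * s := by
        have : ∑ k, (Z k)ᴴ * Z k = t * (∑ k, (R * E k)ᴴ * (R * E k)) * t := by
          rw [Matrix.mul_sum, Matrix.sum_mul]
          refine Finset.sum_congr rfl fun k _ => ?_
          rw [hZ, conjTranspose_mul (R * E k), ht.eq]
          simp only [Matrix.mul_assoc]
        rw [this, hsum]
        calc t * (s * s) * t = t * s * (s * t) := by simp only [Matrix.mul_assoc]
          _ = t * s := by rw [hst, ← Matrix.mul_assoc, htst]
      rw [h1, Complex.ofReal_one, one_smul]
      refine posSemidef_one_sub_of_idempotent ?_ (by rw [← Matrix.mul_assoc, htst])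
      rw [IsHermitian, conjTranspose_mul, ht.eq, hs.1.eq, hst]
    · have h1 : (N * M).trace = ∑ k, b k * (N * Z k).trace := by
        simp [hM, Matrix.mul_sum, Matrix.trace_sum]
      rw [h1]
      exact norm_sum_mul_sq_le hb1.le _
  obtain ⟨u, hu⟩ := hfeas.sqrt zero_le_one
  refine ⟨M * Mᴴ, posSemidef_self_mul_conjTranspose M,
    commutant_mul hMc (commutant_conjTranspose hMc),
    csInf_le (bddBelow_thetaSet _ _) hu.mem_thetaSet, ?_⟩
  have hDM : CFC.sqrt d.scaling * M * s = ∑ k, b k • E k := by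
    rw [hM, Matrix.mul_sum, Matrix.sum_mul]
    refine Finset.sum_congr rfl fun k _ => ?_
    rw [Matrix.mul_smul, Matrix.smul_mul, hZ]
    congr 1
    simp only [← Matrix.mul_assoc, hDR, Matrix.one_mul]
    rw [Matrix.mul_assoc, hEp]
  have hVh : (CFC.sqrt V)ᴴ = CFC.sqrt V := (nonneg_iff_posSemidef.mp (CFC.sqrt_nonneg V)).1
  have hDh : (CFC.sqrt d.scaling)ᴴ = CFC.sqrt d.scaling :=
    (nonneg_iff_posSemidef.mp (CFC.sqrt_nonneg _)).1
  have hαE : ∀ k, (CFC.sqrt V * E k).trace = star (α k) := fun k => by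
    change _ = star ((q k)ᴴ * CFC.sqrt V).trace
    rw [← d.trace_expCommutant_conjTranspose_mul hVs, ← trace_conjTranspose,
      conjTranspose_mul, conjTranspose_conjTranspose, hVh]
  have htr : (CFC.sqrt V * (CFC.sqrt d.scaling * M * s)).trace = r := by
    rw [hDM, Matrix.mul_sum, Matrix.trace_sum]
    have : ∀ k, (CFC.sqrt V * b k • E k).trace = ((‖α k‖ ^ 2 : ℝ) : ℂ) / r := fun k => by
      rw [Matrix.mul_smul, Matrix.trace_smul, hαE, hb, smul_eq_mul, div_mul_eq_mul_div,
        Complex.star_def, Complex.mul_conj, Complex.normSq_eq_norm_sq]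
    simp only [this]
    rw [← Finset.sum_div, ← Complex.ofReal_sum, ← hr2, ← Complex.ofReal_div]
    congr 1
    field_simp
  set G := CFC.sqrt V * CFC.sqrt d.scaling * M with hG
  have hGG : (G * Gᴴ).trace =
      (V * CFC.sqrt d.scaling * (M * Mᴴ) * CFC.sqrt d.scaling).trace := by
    have h1 : G * Gᴴ = CFC.sqrt V * CFC.sqrt d.scaling * (M * Mᴴ) * CFC.sqrt d.scaling *
        CFC.sqrt V := by
      rw [hG]; simp only [conjTranspose_mul, hVh, hDh, Matrix.mul_assoc]
    rw [h1, Matrix.trace_mul_comm]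
    conv_rhs => rw [← CFC.sqrt_mul_sqrt_self V hV.nonneg]
    simp only [Matrix.mul_assoc]
  -- With s² = E(ρ) and Tr E(ρ) = Tr ρ this reads r² ≤ Tr(V√D W√D)·Tr ρ, while θ(S,V)·Tr ρ ≤ r².
  have hcs := norm_trace_conjTranspose_mul_sq_le Gᴴ s
  rw [conjTranspose_conjTranspose, hs.1.eq, hss, d.trace_expCommutant, hGG] at hcs
  have e : (G * s).trace = r := by rw [← htr, hG]; simp only [Matrix.mul_assoc]
  rw [e, Complex.norm_real, Real.norm_eq_abs, sq_abs, hr2] at hcs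
  exact le_of_mul_le_mul_right (hval.trans hcs) hρt

theorem exists_weight_eq [Nonempty n] (hS : IsGraphOver S₀ S) {V : Matrix n n ℂ}
    (hV : V.PosSemidef) (hVc : V ∈ commutant S₀) :
    ∃ W : Matrix n n ℂ, W.PosSemidef ∧ W ∈ commutant S₀ ∧ W ≠ 0 ∧
      ((theta S V * theta (graphCompl S₀ S) W : ℝ) : ℂ) =
        (V * CFC.sqrt d.scaling * W * CFC.sqrt d.scaling).trace := by
  have hnn : ∀ W : Matrix n n ℂ, W.PosSemidef →
      0 ≤ (V * CFC.sqrt d.scaling * W * CFC.sqrt d.scaling).trace := fun W hW => by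
    rw [d.trace_eq_conjTranspose_mul_self hV hW]
    exact (posSemidef_conjTranspose_mul_self _).trace_nonneg
  rcases (theta_nonneg S V).eq_or_lt with h0 | hpos
  -- When θ(S,V) = 0 the inequality forces the nonnegative trace to vanish, so W = 1 works.
  · refine ⟨1, PosSemidef.one, fun K _ => by rw [Matrix.mul_one, Matrix.one_mul], one_ne_zero,
      le_antisymm ?_ (d.trace_le_theta_mul_theta hS hV PosSemidef.one)⟩
    rw [← h0, zero_mul, Complex.ofReal_zero]
    exact hnn 1 PosSemidef.one
  · obtain ⟨W, hW, hWc, h1, h2⟩ := d.exists_weight_of_theta_pos hS hV hVc hpos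
    refine ⟨W, hW, hWc, ?_, le_antisymm ?_ (d.trace_le_theta_mul_theta hS hV hW)⟩
    · rintro rfl
      simp at h2
      linarith
    · have h3 := Complex.nonneg_iff.mp (hnn W hW)
      rw [Complex.le_def]
      refine ⟨?_, by rw [Complex.ofReal_im, ← h3.2]⟩
      rw [Complex.ofReal_re]
      exact (mul_le_of_le_one_right hpos.le h1).trans h2

lemma trace_scaling_comm (V W : Matrix n n ℂ) :
    (W * CFC.sqrt d.scaling * V * CFC.sqrt d.scaling).trace =
      (V * CFC.sqrt d.scaling * W * CFC.sqrt d.scaling).trace := by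
  rw [Matrix.mul_assoc, Matrix.trace_mul_comm]
  simp only [Matrix.mul_assoc]

end BlockDecomposition
end Attainment
end WeightedTheta

theorem mainTheorem4 {n : Type*} [Fintype n] [DecidableEq n] [Nonempty n]
    (S₀ : StarSubalgebra ℂ (Matrix n n ℂ)) (S : Submodule ℂ (Matrix n n ℂ))
    (hS : WeightedTheta.IsGraphOver S₀ S) :
    Nonempty (WeightedTheta.BlockDecomposition S₀) ∧
    ∀ d : WeightedTheta.BlockDecomposition S₀,
      (∀ V W : Matrix n n ℂ, V.PosSemidef → W.PosSemidef →
        (V * CFC.sqrt d.scaling * W * CFC.sqrt d.scaling).trace ≤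
          ((WeightedTheta.theta S V *
            WeightedTheta.theta (WeightedTheta.graphCompl S₀ S) W : ℝ) : ℂ)) ∧
      (∀ V : Matrix n n ℂ, V.PosSemidef → V ∈ WeightedTheta.commutant S₀ →
        ∃ W : Matrix n n ℂ, W.PosSemidef ∧ W ∈ WeightedTheta.commutant S₀ ∧ W ≠ 0 ∧
          ((WeightedTheta.theta S V *
            WeightedTheta.theta (WeightedTheta.graphCompl S₀ S) W : ℝ) : ℂ) =
          (V * CFC.sqrt d.scaling * W * CFC.sqrt d.scaling).trace) ∧
      (∀ W : Matrix n n ℂ, W.PosSemidef → W ∈ WeightedTheta.commutant S₀ →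
        ∃ V : Matrix n n ℂ, V.PosSemidef ∧ V ∈ WeightedTheta.commutant S₀ ∧ V ≠ 0 ∧
          ((WeightedTheta.theta S V *
            WeightedTheta.theta (WeightedTheta.graphCompl S₀ S) W : ℝ) : ℂ) =
          (V * CFC.sqrt d.scaling * W * CFC.sqrt d.scaling).trace) := by
  refine ⟨WeightedTheta.nonempty_blockDecomposition S₀, fun d =>
    ⟨fun V W hV hW => d.trace_le_theta_mul_theta hS hV hW,
      fun V hV hVc => d.exists_weight_eq hS hV hVc, fun W hW hWc => ?_⟩⟩
  -- The roles of the two graphs are exchanged; the trace is symmetric in V and W.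
  obtain ⟨V, hV, hVc, hV0, h⟩ := d.exists_weight_eq hS.graphCompl hW hWc
  rw [hS.graphCompl_graphCompl, d.trace_scaling_comm, mul_comm] at h
  exact ⟨V, hV, hVc, hV0, h⟩
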